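/- Let $p>2$. Let $G$ be the metric graph consisting of a half-line $e_0$ together with a finite number of further edges, each of length in $(0,+\infty]$, attached to $e_0$ at its finite vertex $P$; each bounded attached edge has one other vertex, which belongs to no other edge. Vertices belonging to exactly one edge are called outer. Let $H^1_0(G)$ be the space of real-valued continuous functions $v$ on $G$ whose restriction to each edge $e$ belongs to $H^1(e)$ and which vanish at all outer vertices of $G$. For $v\in H^1_0(G)\setminus\{0\}$ put $$F_{G,p}(v)=\frac{\int_G(|v'|^2+|v|^2)\,dx}{\left(\int_G|v|^p\,dx\right)^{2/p}},$$ where $\int_G$ is the sum of the integrals over the edges of $G$. Let $C_p(G)$ be the best (smallest) constant $C$ in the inequality $$\left(\int_G|v|^p\,dx\right)^{2/p}\le C\int_G(|v'|^2+|v|^2)\,dx\qquad\text{for all } v\in H^1_0(G),$$ that is, $1/C_p(G)=\inf_{v\in H^1_0(G)\setminus\{0\}}F_{G,p}(v)$, and let $C_p(\mathbb R)$ be the best constant in the same inequality for $v\in H^1(\mathbb R)$, with integrals over $\mathbb R$. Then $$0<C_p(\mathbb R)<\infty\quad\text{and}\quad C_p(G)=C_p(\mathbb R).$$ Moreover, unless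 $G$ consists of exactly two half-lines (so that $G$ is equivalent to $\mathbb R$), the problem of minimising $F_{G,p}$ over $H^1_0(G)\setminus\{0\}$ has no solution. -/

import Mathlib

open MeasureTheory Set
open scoped ENNReal ContDiff

noncomputable section

/-- `g` is the weak (distributional) derivative of `f` on the open set `I ⊆ ℝ`:
`∫_I f φ' = - ∫_I g φ` for every `φ ∈ C_c^∞(I)`. -/
def HasWeakDerivOn (I : Set ℝ) (f g : ℝ → ℝ) : Prop :=
  ∀ φ : ℝ → ℝ, ContDiff ℝ ∞ φ → HasCompactSupport φ → tsupport φ ⊆ I →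
    ∫ x in I, f x * deriv φ x = - ∫ x in I, g x * φ x

/-- `f ∈ H¹(I)` with weak derivative `g`: both are square integrable on `I`. -/
structure IsSobolevOn (I : Set ℝ) (f g : ℝ → ℝ) : Prop where
  memLp : MemLp f 2 (volume.restrict I)
  memLp_deriv : MemLp g 2 (volume.restrict I)
  hasWeakDerivOn : HasWeakDerivOn I f g

/-- A metric graph with vertex set `V` and edge set `E`. The edge `e` is a copy of the interval
`[0, len e]` (of `[0, ∞)` if `len e = ∞`). The point `0` is glued to the vertex `init e`; a bounded
edge has its other end glued to a second vertex, an unbounded edge has one endpoint only. -/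
structure MetricGraph (V E : Type*) where
  len : E → ℝ≥0∞
  len_pos : ∀ e, 0 < len e
  init : E → V
  term : E → Option V
  term_eq_none_iff : ∀ e, term e = none ↔ len e = ⊤
  term_ne_init : ∀ e, term e ≠ some (init e)

namespace MetricGraph

variable {V E : Type*}

/-- The vertex `a` belongs to the edge `e`. -/
def Incident (G : MetricGraph V E) (a : V) (e : E) : Prop :=
  G.init e = a ∨ G.term e = some a

/-- The outer vertices are those that belong to exactly one edge. -/
def IsOuter (G : MetricGraph V E) (a : V) : Prop :=
  ∃! e, G.Incident a e

/-- The open interval `(0, len e)`, which parametrises the interior of the edge `e`. -/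
def interval (G : MetricGraph V E) (e : E) : Set ℝ :=
  {x | 0 < x ∧ ENNReal.ofReal x < G.len e}

/-- The interval `[0, len e]`, or `[0, ∞)`, which parametrises the whole edge `e`. -/
def closedInterval (G : MetricGraph V E) (e : E) : Set ℝ :=
  {x | 0 ≤ x ∧ ENNReal.ofReal x ≤ G.len e}

/-- The space `H¹₀(G)`, for a graph with finitely many edges: the functions that are continuous on
`G`, belong to `H¹(e)` for every edge `e`, and vanish at the outer vertices. `val e` is the function
on the edge `e`, `der e` its weak derivative (unique up to null sets) and `vertexVal` gives its
values at the vertices. The values of `val e` and `der e` outside the interval of `e` play no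
role. -/
structure H10 (G : MetricGraph V E) where
  val : E → ℝ → ℝ
  der : E → ℝ → ℝ
  vertexVal : V → ℝ
  isSobolevOn : ∀ e, IsSobolevOn (G.interval e) (val e) (der e)
  continuousOn : ∀ e, ContinuousOn (val e) (G.closedInterval e)
  val_init : ∀ e, val e 0 = vertexVal (G.init e)
  val_term : ∀ e a, G.term e = some a → val e (G.len e).toReal = vertexVal a
  eq_zero_of_isOuter : ∀ a, G.IsOuter a → vertexVal a = 0

variable [Fintype E] {G : MetricGraph V E}

/-- `∫_G (|v'|² + |v|²) dx`. -/
def H10.energy (v : G.H10) : ℝ :=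
  ∑ e, ∫ x in G.interval e, (|v.der e x| ^ 2 + |v.val e x| ^ 2)

/-- `∫_G |v|^p dx`. -/
def H10.powIntegral (p : ℝ) (v : G.H10) : ℝ :=
  ∑ e, ∫ x in G.interval e, |v.val e x| ^ p

/-- `v` is not the zero function on `G`. -/
def H10.NeZero (v : G.H10) : Prop :=
  ∃ e, ∃ x ∈ G.closedInterval e, v.val e x ≠ 0

/-- The quotient `F_{G,p}(v) = ∫_G (|v'|² + |v|²) dx / (∫_G |v|^p dx)^{2/p}`. -/
def H10.quotient (p : ℝ) (v : G.H10) : ℝ :=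
  v.energy / v.powIntegral p ^ (2 / p)

/-- `v` is a solution of the problem of minimising `F_{G,p}` over `H¹₀(G) \ {0}`. -/
def H10.IsMinimizer (p : ℝ) (v : G.H10) : Prop :=
  v.NeZero ∧ ∀ w : G.H10, w.NeZero → v.quotient p ≤ w.quotient p

/-- `C_p(G)`, the best constant `C` in the inequality
`(∫_G |v|^p dx)^{2/p} ≤ C ∫_G (|v'|² + |v|²) dx` for all `v ∈ H¹₀(G)`. -/
def bestConstant (G : MetricGraph V E) (p : ℝ) : ℝ :=
  sInf {C : ℝ | ∀ v : G.H10, v.powIntegral p ^ (2 / p) ≤ C * v.energy}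

end MetricGraph

/-- `C_p(ℝ)`, the best constant `C` in the inequality
`(∫_ℝ |v|^p dx)^{2/p} ≤ C ∫_ℝ (|v'|² + |v|²) dx` for all `v ∈ H¹(ℝ)`. -/
def lineBestConstant (p : ℝ) : ℝ :=
  sInf {C : ℝ | ∀ v v' : ℝ → ℝ, Continuous v → IsSobolevOn univ v v' →
    (∫ x, |v x| ^ p) ^ (2 / p) ≤ C * ∫ x, (|v' x| ^ 2 + |v x| ^ 2)}

/-- The half-line `e₀` (the edge `none`) with further edges of lengths `ℓ i ∈ (0, ∞]` attached to it
at its finite vertex `P` (the vertex `none`). A bounded attached edge `i` has a second vertex, which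
belongs to no other edge. -/
def halfLineWithEdges {ι : Type*} (ℓ : ι → ℝ≥0∞) (hℓ : ∀ i, 0 < ℓ i) :
    MetricGraph (Option {i : ι // ℓ i ≠ ⊤}) (Option ι) where
  len e := e.elim ⊤ ℓ
  len_pos e := by
    cases e with
    | none => simp
    | some i => exact hℓ i
  init _ := none
  term e := e.elim none fun i => if h : ℓ i ≠ ⊤ then some (some ⟨i, h⟩) else none
  term_eq_none_iff e := by
    cases e with
    | none => simp
    | some i => simp
  term_ne_init e := by
    cases e with
    | none => simp
    | some i => by_cases h : ℓ i = ⊤ <;> simp [h]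

end

/-! Extension by zero turns every edge into a half-line, since functions in `H10` vanish at outer
vertices. A function on the graph thus becomes a finite family of functions in H¹(0, ∞) with a
common value at 0. Two such functions glue to a function on ℝ, so the inequality on ℝ is an
inequality for pairs (`IsPairConstant`, `isPairConstant_iff`).

Equality of the constants. With at least two edges, apply the pair inequality to all ordered pairs
of distinct edges and add up. Because 2/p ≤ 1, the function s ↦ s^(2/p) lies above its chord on [0,
S], where S is the total power integral, and the sum is the inequality on the graph
(`IsPairConstant.sum_rpow_le`). Conversely, functions supported on e₀ and vanishing at P already
give the constant of the line: cut a function on ℝ at -t, bring it to zero by a linear ramp,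
translate, and let t → ∞ (`isPairConstant_of_forall_eq_zero`).

Non-existence. A minimiser gives equality in the inequality. With three or more edges, strictness of
the chord bound confines it to a single edge, so it vanishes at P; with no attached edge it vanishes
at P by the boundary condition; with one bounded attached edge it is an extremal on ℝ that vanishes
on a half-line. In each case there is an extremal f on a half-line with f(0) = 0. Replacing f on [0,
δ] by a ramp of height f(δ) saves the energy D of [0, δ] and loses only O(δ)·D, so D = 0 for small
δ. This δ depends only on bounds for energy and power, so the argument repeats on [δ, 2δ] and so on,
whence f = 0 (`IsPairConstant.exists_forall_eq_zero`, `IsPairConstant.halfLinePow_eq_zero`). No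
Euler–Lagrange equation is needed. -/

noncomputable section

/-! ### Weak derivatives and primitives on intervals -/

lemma exists_Icc_subset_of_isCompact {I K : Set ℝ} (hK : IsCompact K)
    (hKI : K ⊆ I) {a : ℝ} (ha : a ∈ I) :
    ∃ c d, c ∈ I ∧ d ∈ I ∧ a ∈ Icc c d ∧ K ⊆ Icc c d := by
  have hc : IsCompact (insert a K) := hK.insert a
  have hne : (insert a K).Nonempty := ⟨a, mem_insert _ _⟩
  have hsub : insert a K ⊆ I := insert_subset ha hKI
  obtain ⟨c, hc1, hc2⟩ := hc.exists_isLeast hne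
  obtain ⟨d, hd1, hd2⟩ := hc.exists_isGreatest hne
  exact ⟨c, d, hsub hc1, hsub hd1, ⟨hc2 (mem_insert _ _), hd2 (mem_insert _ _)⟩,
    fun x hx => ⟨hc2 (mem_insert_of_mem _ hx), hd2 (mem_insert_of_mem _ hx)⟩⟩

/-- A set integral of a function vanishing off `[c, d]` is an interval integral. -/
lemma setIntegral_eq_intervalIntegral_of_forall_eq_zero {I : Set ℝ} {F : ℝ → ℝ} {c d : ℝ}
    (hI : MeasurableSet I) (hcd : c ≤ d) (hsub : Icc c d ⊆ I) (h0 : ∀ x, x ∉ Icc c d → F x = 0) :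
    ∫ x in I, F x = ∫ x in c..d, F x := by
  rw [intervalIntegral.integral_of_le hcd, ← integral_Icc_eq_integral_Ioc]
  exact (setIntegral_eq_of_subset_of_forall_sdiff_eq_zero hI hsub fun x hx => h0 x hx.2)

/-- The support is open, so inside `[c, d]` it lies in the interior. This removes the boundary terms
when integrating by parts. -/
lemma eq_zero_of_forall_notMem_Icc {φ : ℝ → ℝ} {c d : ℝ} (hφ : Continuous φ)
    (h0 : ∀ x, x ∉ Icc c d → φ x = 0) : φ c = 0 ∧ φ d = 0 := by
  have hs : Function.support φ ⊆ Ioo c d := by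
    rw [← interior_Icc]
    refine interior_maximal (fun x hx => ?_) hφ.isOpen_support
    by_contra h
    exact hx (h0 x h)
  constructor <;> by_contra h
  · exact absurd (hs h).1 (lt_irrefl c)
  · exact absurd (hs h).2 (lt_irrefl d)

/-- Integration by parts for the primitive of an integrable function against a `C¹` function. -/
lemma integral_primitive_mul_deriv {g φ : ℝ → ℝ} {a c d : ℝ} (hg : IntervalIntegrable g volume c d)
    (ha : a ∈ uIcc c d) (hφ : ContDiff ℝ 1 φ) (hc : φ c = 0) (hd : φ d = 0) :
    ∫ x in c..d, (∫ t in a..x, g t) * deriv φ x = - ∫ x in c..d, g x * φ x := by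
  have h1 := hg.absolutelyContinuousOnInterval_intervalIntegral ha
  rw [h1.integral_mul_deriv_eq_deriv_mul hφ.contDiffOn.absolutelyContinuousOnInterval, hc, hd]
  simp only [mul_zero, sub_zero, zero_sub, neg_inj]
  apply intervalIntegral.integral_congr_ae
  filter_upwards [hg.ae_hasDerivAt_integral] with x hx hxm
  rw [(hx (uIoc_subset_uIcc hxm) a ha).deriv]

/-- The primitive of a smooth function with vanishing integral and support in `I` is a test
function on `I`. -/
lemma exists_primitive_test_function {I : Set ℝ} (hI : I.OrdConnected) {ψ : ℝ → ℝ}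
    (hψ : ContDiff ℝ ∞ ψ) (hψc : HasCompactSupport ψ) (hψI : tsupport ψ ⊆ I)
    (hψ0 : ∫ x, ψ x = 0) {a : ℝ} (ha : a ∈ I) :
    ∃ φ : ℝ → ℝ, ContDiff ℝ ∞ φ ∧ HasCompactSupport φ ∧ tsupport φ ⊆ I ∧ deriv φ = ψ := by
  obtain ⟨c, d, hc, hd, had, hsub⟩ := exists_Icc_subset_of_isCompact hψc hψI ha
  have hcd : c ≤ d := had.1.trans had.2
  have hz : ∀ x, x ∉ Icc c d → ψ x = 0 := fun x hx =>
    image_eq_zero_of_notMem_tsupport fun h => hx (hsub h)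
  have hder : ∀ x, HasDerivAt (fun x => ∫ t in c..x, ψ t) (ψ x) x := fun x =>
    intervalIntegral.integral_hasDerivAt_right (hψ.continuous.intervalIntegrable _ _)
      (hψ.continuous.stronglyMeasurableAtFilter _ _) hψ.continuous.continuousAt
  have hderiv : deriv (fun x => ∫ t in c..x, ψ t) = ψ := funext fun x => (hder x).deriv
  have hzero : ∀ x, x ∉ Icc c d → ∫ t in c..x, ψ t = 0 := by
    intro x hx
    rcases lt_or_ge x c with h | h
    · rw [intervalIntegral.integral_symm, neg_eq_zero, intervalIntegral.integral_of_le h.le,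
        integral_Ioc_eq_integral_Ioo]
      exact setIntegral_eq_zero_of_forall_eq_zero fun t ht => hz t fun h' => absurd h'.1 ht.2.not_ge
    · have hdx : d < x := by
        by_contra! hh
        exact hx ⟨h, hh⟩
      rw [← setIntegral_eq_intervalIntegral_of_forall_eq_zero MeasurableSet.univ h
        (subset_univ _) fun t ht => hz t fun h' => ht ⟨h'.1, h'.2.trans hdx.le⟩]
      simpa using hψ0
  have hts : tsupport (fun x => ∫ t in c..x, ψ t) ⊆ Icc c d := by
    refine closure_minimal (fun x hx => ?_) isClosed_Icc
    by_contra h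
    exact hx (hzero x h)
  refine ⟨fun x => ∫ t in c..x, ψ t, ?_, ?_, hts.trans (hI.out hc hd), hderiv⟩
  · rw [contDiff_infty_iff_deriv, hderiv]
    exact ⟨fun x => (hder x).differentiableAt, hψ⟩
  · exact HasCompactSupport.of_support_subset_isCompact isCompact_Icc
      (subset_closure.trans hts)

/-- The du Bois-Reymond lemma: a continuous function with vanishing weak derivative on an open
interval is constant there. -/
lemma eq_of_forall_integral_mul_deriv_eq_zero {I : Set ℝ} (hI : I.OrdConnected) (hIo : IsOpen I)
    {h : ℝ → ℝ} (hc : ContinuousOn h I)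
    (h0 : ∀ φ : ℝ → ℝ, ContDiff ℝ ∞ φ → HasCompactSupport φ → tsupport φ ⊆ I →
      ∫ x in I, h x * deriv φ x = 0) {a b : ℝ} (ha : a ∈ I) (hb : b ∈ I) : h a = h b := by
  obtain ⟨r, hr, hrI⟩ := Metric.isOpen_iff.1 hIo a ha
  let B : ContDiffBump a := ⟨r / 4, r / 2, by positivity, by linarith⟩
  set η : ℝ → ℝ := B.normed volume with hη
  have hηs : ContDiff ℝ ∞ η := B.contDiff_normed
  have hηc : HasCompactSupport η := B.hasCompactSupport_normed
  have hηI : tsupport η ⊆ I := by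
    rw [hη, B.tsupport_normed_eq]
    exact (Metric.closedBall_subset_ball (by change r / 2 < r; linarith)).trans hrI
  have hη1 : ∫ x, η x = 1 := B.integral_normed
  have hint : ∀ ψ : ℝ → ℝ, ContDiff ℝ ∞ ψ → HasCompactSupport ψ → tsupport ψ ⊆ I →
      Integrable (fun x => h x * ψ x) (volume.restrict I) := by
    intro ψ h1 h2 h3
    have h4 : IntegrableOn (fun x => h x * ψ x) (tsupport ψ) :=
      ((hc.mono h3).mul h1.continuous.continuousOn).integrableOn_compact h2
    refine h4.of_forall_sdiff_eq_zero hIo.measurableSet fun x hx => ?_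
    rw [image_eq_zero_of_notMem_tsupport hx.2, mul_zero]
  set K := ∫ x in I, h x * η x with hK
  have hae : ∀ᵐ x ∂volume, x ∈ I → h x - K = 0 := by
    refine hIo.ae_eq_zero_of_integral_contDiff_smul_eq_zero
      ((hc.sub continuousOn_const).locallyIntegrableOn hIo.measurableSet) ?_
    intro ψ h1 h2 h3
    set m := ∫ x, ψ x with hm
    have hψi : Integrable ψ := h1.continuous.integrable_of_hasCompactSupport h2
    have hηi : Integrable η := hηs.continuous.integrable_of_hasCompactSupport hηc
    -- Subtracting `m * η` makes the integral zero, so the difference is the derivative of a test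
    -- function; testing with it yields `∫ h ψ = m * K`.
    obtain ⟨φ, p1, p2, p3, p4⟩ := exists_primitive_test_function hI
      (ψ := fun x => ψ x - m * η x) (h1.sub (contDiff_const.mul hηs)) (h2.sub hηc.mul_left)
      ((tsupport_sub _ _).trans (union_subset h3 ((tsupport_mul_subset_right).trans hηI)))
      (by rw [integral_sub hψi (hηi.const_mul m), integral_const_mul, hη1]; simp [hm]) ha
    have h5 := h0 φ p1 p2 p3
    rw [p4] at h5
    have h6 : ∫ x in I, h x * (ψ x - m * η x) = (∫ x in I, h x * ψ x) - m * K := by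
      rw [hK, ← integral_const_mul, ← integral_sub (hint ψ h1 h2 h3)
        ((hint η hηs hηc hηI).const_mul m)]
      congr 1 with x
      ring
    rw [h6] at h5
    have h7 : ∫ x, ψ x • (h x - K) = ∫ x in I, ψ x • (h x - K) := by
      symm
      refine setIntegral_eq_integral_of_forall_compl_eq_zero fun x hx => ?_
      rw [image_eq_zero_of_notMem_tsupport fun h => hx (h3 h), zero_smul]
    have h8 : ∫ x in I, ψ x = m := by
      rw [hm]
      refine setIntegral_eq_integral_of_forall_compl_eq_zero fun x hx => ?_
      rw [image_eq_zero_of_notMem_tsupport fun h => hx (h3 h)]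
    rw [h7]
    calc ∫ x in I, ψ x • (h x - K) = ∫ x in I, (h x * ψ x - K * ψ x) := by
          congr 1 with x
          simp only [smul_eq_mul]; ring
      _ = (∫ x in I, h x * ψ x) - K * m := by
          rw [integral_sub (hint ψ h1 h2 h3) (hψi.restrict.const_mul K), integral_const_mul, h8]
      _ = 0 := by linarith
  have hall : ∀ x ∈ I, h x = K := by
    have : EqOn h (fun _ => K) I := by
      refine Measure.eqOn_open_of_ae_eq (μ := volume) ?_ hIo hc continuousOn_const
      rw [Filter.EventuallyEq, ae_restrict_iff' hIo.measurableSet]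
      filter_upwards [hae] with x hx hxI
      linarith [hx hxI]
    exact this
  rw [hall a ha, hall b hb]

/-- A continuous function on an open interval is a primitive of its weak derivative. -/
lemma HasWeakDerivOn.sub_eq_integral {I : Set ℝ} (hI : I.OrdConnected) (hIo : IsOpen I)
    {f g : ℝ → ℝ} (hf : ContinuousOn f I) (hg : LocallyIntegrableOn g I)
    (h : HasWeakDerivOn I f g) {a b : ℝ} (ha : a ∈ I) (hb : b ∈ I) :
    f b - f a = ∫ t in a..b, g t := by
  have hgi : ∀ c ∈ I, ∀ d ∈ I, IntervalIntegrable g volume c d := fun c hc d hd =>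
    ((hg.integrableOn_compact_subset (hI.uIcc_subset hc hd) isCompact_uIcc)).intervalIntegrable
  have hGc : ContinuousOn (fun x => ∫ t in a..x, g t) I := by
    intro x hx
    -- Continuity is local: near `x` the primitive is a constant plus an absolutely continuous
    -- primitive based at `x`.
    obtain ⟨r, hr, hrI⟩ := Metric.isOpen_iff.1 hIo x hx
    have hm1 : x - r / 2 ∈ I := hrI (by rw [Metric.mem_ball, Real.dist_eq, abs_lt]; constructor <;> linarith)
    have hm2 : x + r / 2 ∈ I := hrI (by rw [Metric.mem_ball, Real.dist_eq, abs_lt]; constructor <;> linarith)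
    have h1 := (hgi _ hm1 _ hm2).absolutelyContinuousOnInterval_intervalIntegral
      (c := x) (by rw [uIcc_of_le (by linarith)]; constructor <;> linarith)
    have h2 : ContinuousAt (fun y => ∫ t in x..y, g t) x := h1.continuousOn.continuousAt (by
      rw [uIcc_of_le (by linarith)]; exact Icc_mem_nhds (by linarith) (by linarith))
    have h3 : ContinuousWithinAt (fun y => (∫ t in a..x, g t) + ∫ t in x..y, g t) I x :=
      (continuousAt_const.add h2).continuousWithinAt
    refine h3.congr (fun y hy => ?_) (by simp)
    rw [intervalIntegral.integral_add_adjacent_intervals (hgi a ha x hx) (hgi x hx y hy)]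
  have key := eq_of_forall_integral_mul_deriv_eq_zero hI hIo
    (h := fun x => f x - ∫ t in a..x, g t) (hf.sub hGc) ?_ ha hb
  · simp only [intervalIntegral.integral_same] at key
    linarith
  · intro φ h1 h2 h3
    obtain ⟨c, d, hc, hd, had, hsub⟩ := exists_Icc_subset_of_isCompact h2 h3 ha
    have hcd : c ≤ d := had.1.trans had.2
    have hcdI : Icc c d ⊆ I := hI.out hc hd
    have hz : ∀ x, x ∉ Icc c d → φ x = 0 := fun x hx =>
      image_eq_zero_of_notMem_tsupport fun h => hx (hsub h)
    have hz' : ∀ x, x ∉ Icc c d → deriv φ x = 0 := fun x hx => by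
      by_contra h'
      exact hx (hsub (support_deriv_subset h'))
    obtain ⟨hφc, hφd⟩ := eq_zero_of_forall_notMem_Icc h1.continuous hz
    have ha' : a ∈ uIcc c d := by rwa [uIcc_of_le hcd]
    have hpart := integral_primitive_mul_deriv (hgi c hc d hd) ha' (h1.of_le (by simp)) hφc hφd
    have hw := h φ h1 h2 h3
    rw [setIntegral_eq_intervalIntegral_of_forall_eq_zero hIo.measurableSet hcd hcdI
        (fun x hx => by rw [hz' x hx, mul_zero]),
      setIntegral_eq_intervalIntegral_of_forall_eq_zero hIo.measurableSet hcd hcdI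
        (fun x hx => by rw [hz x hx, mul_zero])] at hw
    rw [setIntegral_eq_intervalIntegral_of_forall_eq_zero hIo.measurableSet hcd hcdI
        (fun x hx => by rw [hz' x hx, mul_zero])]
    have hcont : ContinuousOn (deriv φ) (uIcc c d) :=
      (h1.continuous_deriv (by simp)).continuousOn
    have hu : uIcc c d ⊆ I := by rwa [uIcc_of_le hcd]
    simp only [sub_mul]
    rw [intervalIntegral.integral_sub, hw, hpart, sub_self]
    · exact ((hf.mono hu).mul hcont).intervalIntegrable
    · exact ((hGc.mono hu).mul hcont).intervalIntegrable

/-- A primitive of a locally integrable function has that function as its weak derivative. -/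
lemma hasWeakDerivOn_of_forall_eq_add_integral {f g : ℝ → ℝ} {I : Set ℝ}
    (hg : ∀ c d, IntervalIntegrable g volume c d)
    (h : ∀ x, f x = f 0 + ∫ t in 0..x, g t) : HasWeakDerivOn I f g := by
  intro φ h1 h2 h3
  obtain ⟨c, d, -, -, had, hsub⟩ := exists_Icc_subset_of_isCompact h2 (subset_univ _)
    (mem_univ (0 : ℝ))
  have hcd : c ≤ d := had.1.trans had.2
  have hz : ∀ x, x ∉ Icc c d → φ x = 0 := fun x hx =>
    image_eq_zero_of_notMem_tsupport fun h => hx (hsub h)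
  have hz' : ∀ x, x ∉ Icc c d → deriv φ x = 0 := fun x hx => by
    by_contra h'
    exact hx (hsub (support_deriv_subset h'))
  obtain ⟨hφc, hφd⟩ := eq_zero_of_forall_notMem_Icc h1.continuous hz
  have hφI : ∀ x ∉ I, φ x = 0 := fun x hx =>
    image_eq_zero_of_notMem_tsupport fun h => hx (h3 h)
  have hφI' : ∀ x ∉ I, deriv φ x = 0 := fun x hx => by
    by_contra h'
    exact hx (h3 (support_deriv_subset h'))
  rw [setIntegral_eq_integral_of_forall_compl_eq_zero fun x hx => by rw [hφI' x hx, mul_zero],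
    setIntegral_eq_integral_of_forall_compl_eq_zero fun x hx => by rw [hφI x hx, mul_zero],
    ← setIntegral_univ,
    setIntegral_eq_intervalIntegral_of_forall_eq_zero MeasurableSet.univ hcd (subset_univ _)
      fun x hx => by rw [hz' x hx, mul_zero],
    ← setIntegral_univ,
    setIntegral_eq_intervalIntegral_of_forall_eq_zero MeasurableSet.univ hcd (subset_univ _)
      fun x hx => by rw [hz x hx, mul_zero]]
  have hpart := integral_primitive_mul_deriv (hg c d) (a := 0) (by rwa [uIcc_of_le hcd])
    (h1.of_le (by simp)) hφc hφd
  -- This disposes of the constant `f 0` in the formula for `f`.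
  have hder : ∫ x in c..d, deriv φ x = 0 := by
    rw [intervalIntegral.integral_deriv_eq_sub (fun x _ => (h1.differentiable (by simp)) x)
      (h1.continuous_deriv (by simp)).continuousOn.intervalIntegrable, hφc, hφd, sub_self]
  have hcont : ContinuousOn (deriv φ) (uIcc c d) := (h1.continuous_deriv (by simp)).continuousOn
  have hGc : ContinuousOn (fun x => ∫ t in 0..x, g t) (uIcc c d) :=
    ((hg c d).absolutelyContinuousOnInterval_intervalIntegral
      (by rwa [uIcc_of_le hcd])).continuousOn
  generalize f 0 = k at h
  simp_rw [h, add_mul]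
  rw [intervalIntegral.integral_add, intervalIntegral.integral_const_mul, hder, hpart]
  · ring
  · exact (continuousOn_const.mul hcont).intervalIntegrable
  · exact (hGc.mul hcont).intervalIntegrable

/-! ### Sobolev functions on the half-line -/

/-- `f` belongs to `H¹(0, ∞)` with derivative `g`, and is the continuous representative. -/
structure IsHalfLineSobolev (f g : ℝ → ℝ) : Prop where
  memLp : MemLp f 2 (volume.restrict (Ioi 0))
  memLp_deriv : MemLp g 2 (volume.restrict (Ioi 0))
  eq_add_integral : ∀ x, 0 ≤ x → f x = f 0 + ∫ t in 0..x, g t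

/-- The density `|f'|² + |f|²`. -/
def energyDensity (f g : ℝ → ℝ) (x : ℝ) : ℝ := |g x| ^ 2 + |f x| ^ 2

lemma energyDensity_nonneg (f g : ℝ → ℝ) (x : ℝ) : 0 ≤ energyDensity f g x := by
  unfold energyDensity; positivity

def halfLineEnergy (f g : ℝ → ℝ) : ℝ := ∫ x in Ioi 0, energyDensity f g x

def halfLinePow (p : ℝ) (f : ℝ → ℝ) : ℝ := ∫ x in Ioi 0, |f x| ^ p

lemma halfLineEnergy_nonneg (f g : ℝ → ℝ) : 0 ≤ halfLineEnergy f g :=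
  integral_nonneg fun x => energyDensity_nonneg f g x

lemma halfLinePow_nonneg (p : ℝ) (f : ℝ → ℝ) : 0 ≤ halfLinePow p f :=
  integral_nonneg fun x => by positivity

lemma integrable_energyDensity {μ : Measure ℝ} {f g : ℝ → ℝ} (hf : MemLp f 2 μ)
    (hg : MemLp g 2 μ) : Integrable (energyDensity f g) μ := by
  have h := hg.integrable_sq.add hf.integrable_sq
  refine h.congr (Filter.Eventually.of_forall fun x => ?_)
  simp [energyDensity, sq_abs]

/-- The Cauchy-Schwarz inequality for the mean of `g` over `[a, b]`. -/
lemma sq_integral_le_mul_integral_sq {g : ℝ → ℝ} {a b : ℝ} (hab : a ≤ b)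
    (hg : MemLp g 2 (volume.restrict (Ioc a b))) :
    (∫ x in a..b, g x) ^ 2 ≤ (b - a) * ∫ x in Ioc a b, g x ^ 2 := by
  rw [intervalIntegral.integral_of_le hab]
  have hg1 : Integrable g (volume.restrict (Ioc a b)) := hg.integrable (by norm_num)
  have hg2 := hg.integrable_sq
  rcases hab.eq_or_lt with rfl | hlt
  · simp
  have hpos : 0 < b - a := sub_pos.2 hlt
  set S := ∫ x in Ioc a b, g x with hS
  -- Expanding the non-negative variance of `g` about its mean gives the inequality.
  have h0 : 0 ≤ ∫ x in Ioc a b, (g x - S / (b - a)) ^ 2 := integral_nonneg fun x => sq_nonneg _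
  have h1 : ∫ x in Ioc a b, (g x - S / (b - a)) ^ 2
      = (∫ x in Ioc a b, g x ^ 2) - 2 * (S / (b - a)) * S + (b - a) * (S / (b - a)) ^ 2 := by
    have : ∀ x, (g x - S / (b - a)) ^ 2
        = (g x ^ 2 - 2 * (S / (b - a)) * g x) + (S / (b - a)) ^ 2 := fun x => by ring
    simp_rw [this]
    have hA : Integrable (fun x => g x ^ 2 - 2 * (S / (b - a)) * g x)
        (volume.restrict (Ioc a b)) := hg2.sub (hg1.const_mul _)
    rw [integral_add hA (integrable_const _),
      integral_sub hg2 (hg1.const_mul _), integral_const_mul, ← hS]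
    simp [measureReal_def, hab]
  rw [h1] at h0
  have h2 : (b - a) * (S / (b - a)) = S := by field_simp
  have h3 : 0 ≤ (∫ x in Ioc a b, g x ^ 2) - S * (S / (b - a)) := by
    have : (b - a) * (S / (b - a)) ^ 2 = S * (S / (b - a)) := by rw [sq, ← mul_assoc, h2]
    linarith
  calc S ^ 2 = (b - a) * (S * (S / (b - a))) := by rw [mul_left_comm, h2, sq]
    _ ≤ _ := by gcongr; linarith

/-- The fundamental theorem of calculus for weak derivatives, up to the end points. -/
lemma HasWeakDerivOn.sub_eq_integral_Icc {f g : ℝ → ℝ} {a b : ℝ} (hab : a ≤ b)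
    (hf : ContinuousOn f (Icc a b)) (hg : IntegrableOn g (Ioo a b))
    (h : HasWeakDerivOn (Ioo a b) f g) : f b - f a = ∫ t in a..b, g t := by
  rcases hab.eq_or_lt with rfl | hlt
  · simp
  have hgi : IntervalIntegrable g volume a b := by
    rw [intervalIntegrable_iff_integrableOn_Ioo_of_le hab]; exact hg
  have hgi' : ∀ x ∈ Icc a b, ∀ y ∈ Icc a b, IntervalIntegrable g volume x y := fun x hx y hy =>
    hgi.mono_set (by rw [uIcc_of_le hab]; exact (ordConnected_Icc).uIcc_subset hx hy)
  have hGc : ContinuousOn (fun x => ∫ t in a..x, g t) (Icc a b) := by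
    have := (hgi.absolutelyContinuousOnInterval_intervalIntegral left_mem_uIcc).continuousOn
    rwa [uIcc_of_le hab] at this
  obtain ⟨m, hm⟩ := nonempty_Ioo.2 hlt
  have hamem : a ∈ Icc a b := left_mem_Icc.2 hab
  have hconst : EqOn (fun x => f x - ∫ t in a..x, g t) (fun _ => f m - ∫ t in a..m, g t)
      (Ioo a b) := by
    intro x hx
    have h1 := h.sub_eq_integral ordConnected_Ioo isOpen_Ioo (hf.mono Ioo_subset_Icc_self)
      hg.locallyIntegrableOn hm hx
    have h2 := intervalIntegral.integral_add_adjacent_intervals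
      (hgi' a hamem m (Ioo_subset_Icc_self hm))
      (hgi' m (Ioo_subset_Icc_self hm) x (Ioo_subset_Icc_self hx))
    simp only
    linarith
  -- Constancy on the open interval passes to the end points by continuity.
  have hall := hconst.of_subset_closure (hf.sub hGc) continuousOn_const Ioo_subset_Icc_self
    (closure_Ioo hlt.ne).ge
  have h1 := hall hamem
  have h2 := hall (right_mem_Icc.2 hab)
  simp only [intervalIntegral.integral_same] at h1 h2
  linarith

lemma HasWeakDerivOn.mono {I J : Set ℝ} {f g : ℝ → ℝ} (h : HasWeakDerivOn I f g)
    (hI : MeasurableSet I) (hJI : J ⊆ I) : HasWeakDerivOn J f g := by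
  intro φ h1 h2 h3
  have hφ : ∀ x ∈ I \ J, φ x = 0 := fun x hx =>
    image_eq_zero_of_notMem_tsupport fun h => hx.2 (h3 h)
  have hφ' : ∀ x ∈ I \ J, deriv φ x = 0 := fun x hx => by
    by_contra h'
    exact hx.2 (h3 (support_deriv_subset h'))
  have := h φ h1 h2 (h3.trans hJI)
  rwa [setIntegral_eq_of_subset_of_forall_sdiff_eq_zero hI hJI
      fun x hx => by rw [hφ' x hx, mul_zero],
    setIntegral_eq_of_subset_of_forall_sdiff_eq_zero hI hJI
      fun x hx => by rw [hφ x hx, mul_zero]] at this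

namespace IsHalfLineSobolev

variable {f g : ℝ → ℝ}

lemma memLp_deriv_Ioc (h : IsHalfLineSobolev f g) {a b : ℝ} (ha : 0 ≤ a) :
    MemLp g 2 (volume.restrict (Ioc a b)) :=
  h.memLp_deriv.mono_measure (Measure.restrict_mono (fun _ hx => ha.trans_lt hx.1) le_rfl)

lemma intervalIntegrable (h : IsHalfLineSobolev f g) {a b : ℝ} (ha : 0 ≤ a) (hb : 0 ≤ b) :
    IntervalIntegrable g volume a b :=
  ⟨(h.memLp_deriv_Ioc ha).integrable (by norm_num), (h.memLp_deriv_Ioc hb).integrable (by norm_num)⟩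

lemma sub_eq_integral (h : IsHalfLineSobolev f g) {a b : ℝ} (ha : 0 ≤ a) (hb : 0 ≤ b) :
    f b - f a = ∫ t in a..b, g t := by
  have := intervalIntegral.integral_add_adjacent_intervals (h.intervalIntegrable le_rfl ha)
    (h.intervalIntegrable ha hb)
  rw [h.eq_add_integral b hb, h.eq_add_integral a ha]
  linarith

lemma continuousOn (h : IsHalfLineSobolev f g) : ContinuousOn f (Ici 0) := by
  intro x hx
  have hx0 : (0 : ℝ) ≤ x := hx
  have h1 := (h.intervalIntegrable le_rfl (by linarith : (0 : ℝ) ≤ x + 1)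
    ).absolutelyContinuousOnInterval_intervalIntegral (c := 0) left_mem_uIcc
  have h2 : ContinuousOn f (Icc 0 (x + 1)) := by
    have h3 := h1.continuousOn
    rw [uIcc_of_le (by linarith)] at h3
    exact (continuousOn_const.add h3).congr fun y hy => h.eq_add_integral y hy.1
  refine (h2 x ⟨hx0, by linarith⟩).mono_of_mem_nhdsWithin ?_
  have : Iio (x + 1) ∈ nhdsWithin x (Ici 0) := mem_nhdsWithin_of_mem_nhds (Iio_mem_nhds (by linarith))
  filter_upwards [this, self_mem_nhdsWithin] with y h1 h2
  exact ⟨h2, h1.le⟩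

lemma integrableOn_energyDensity (h : IsHalfLineSobolev f g) :
    IntegrableOn (energyDensity f g) (Ioi 0) :=
  integrable_energyDensity h.memLp h.memLp_deriv

lemma sq_sub_le (h : IsHalfLineSobolev f g) {a b : ℝ} (ha : 0 ≤ a) (hab : a ≤ b) :
    (f b - f a) ^ 2 ≤ (b - a) * ∫ x in Ioc a b, g x ^ 2 := by
  rw [h.sub_eq_integral ha (ha.trans hab)]
  exact sq_integral_le_mul_integral_sq hab (h.memLp_deriv_Ioc ha)

lemma setIntegral_sq_deriv_le (h : IsHalfLineSobolev f g) {a : ℝ} (ha : 0 ≤ a) {s t : Set ℝ}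
    (hst : s ⊆ t) (ht : t ⊆ Ioi a) (htm : MeasurableSet t) :
    ∫ x in s, g x ^ 2 ≤ ∫ x in t, energyDensity f g x := by
  have hsub : t ⊆ Ioi 0 := ht.trans (Ioi_subset_Ioi ha)
  have h1 : IntegrableOn (fun x => g x ^ 2) t :=
    IntegrableOn.mono_set h.memLp_deriv.integrable_sq hsub
  refine (setIntegral_mono_set h1 (Filter.Eventually.of_forall fun x => sq_nonneg _)
    hst.eventuallyLE).trans
    (setIntegral_mono_on h1 (h.integrableOn_energyDensity.mono_set hsub) htm fun x _ => ?_)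
  simp only [energyDensity, sq_abs]
  nlinarith [sq_nonneg (f x)]

/-- Pointwise bound by the energy of the tail. -/
lemma sq_le_two_mul_integral (h : IsHalfLineSobolev f g) {a : ℝ} (ha : 0 ≤ a) :
    f a ^ 2 ≤ 2 * ∫ x in Ioi a, energyDensity f g x := by
  have hsub : Ioc a (a + 1) ⊆ Ioi a := fun x hx => hx.1
  have hsub0 : Ioc a (a + 1) ⊆ Ioi 0 := fun x hx => ha.trans_lt hx.1
  set D := ∫ x in Ioc a (a + 1), g x ^ 2 with hD
  have hD0 : 0 ≤ D := integral_nonneg fun x => sq_nonneg _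
  have hfi : IntegrableOn (fun x => f x ^ 2) (Ioc a (a + 1)) :=
    IntegrableOn.mono_set h.memLp.integrable_sq hsub0
  have hgi : IntegrableOn (fun x => g x ^ 2) (Ioc a (a + 1)) :=
    IntegrableOn.mono_set h.memLp_deriv.integrable_sq hsub0
  -- From `f a ^ 2 ≤ 2 * f x ^ 2 + 2 * (f x - f a) ^ 2` and Cauchy-Schwarz with `x - a ≤ 1`;
  -- averaging over an interval of length one then gives the factor 2.
  have hpt : ∀ x ∈ Ioc a (a + 1), f a ^ 2 ≤ 2 * f x ^ 2 + 2 * D := by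
    intro x hx
    have h1 := h.sq_sub_le ha hx.1.le
    have h2 : ∫ y in Ioc a x, g y ^ 2 ≤ D :=
      setIntegral_mono_set hgi (Filter.Eventually.of_forall fun x => sq_nonneg _)
        (Ioc_subset_Ioc_right hx.2).eventuallyLE
    have h3 : (f x - f a) ^ 2 ≤ D := by
      have h4 : 0 ≤ ∫ y in Ioc a x, g y ^ 2 := integral_nonneg fun x => sq_nonneg _
      have h5 : x - a ≤ 1 := by linarith [hx.2]
      have h6 : 0 ≤ x - a := by linarith [hx.1]
      nlinarith
    nlinarith [sq_nonneg (f a - 2 * f x)]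
  have hI : ∫ _ in Ioc a (a + 1), f a ^ 2 ≤ ∫ x in Ioc a (a + 1), (2 * f x ^ 2 + 2 * D) :=
    setIntegral_mono_on (integrable_const _) ((hfi.const_mul 2).add (integrable_const _))
      measurableSet_Ioc hpt
  have h1 : ∫ _ in Ioc a (a + 1), f a ^ 2 = f a ^ 2 := by simp [measureReal_def]
  have h2 : ∫ x in Ioc a (a + 1), (2 * f x ^ 2 + 2 * D)
      = 2 * ∫ x in Ioc a (a + 1), energyDensity f g x := by
    rw [integral_add (hfi.const_mul 2) (integrable_const _), integral_const_mul]
    simp only [energyDensity, sq_abs]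
    rw [integral_add hgi hfi, ← hD]
    simp [measureReal_def]
    ring
  rw [h1, h2] at hI
  refine hI.trans (mul_le_mul_of_nonneg_left ?_ zero_le_two)
  exact setIntegral_mono_set (h.integrableOn_energyDensity.mono_set (Ioi_subset_Ioi ha))
    (Filter.Eventually.of_forall fun x => energyDensity_nonneg _ _ _) hsub.eventuallyLE

lemma sq_le_two_mul_energy (h : IsHalfLineSobolev f g) {a : ℝ} (ha : 0 ≤ a) :
    f a ^ 2 ≤ 2 * halfLineEnergy f g := by
  refine (h.sq_le_two_mul_integral ha).trans (mul_le_mul_of_nonneg_left ?_ zero_le_two)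
  exact setIntegral_mono_set h.integrableOn_energyDensity
    (Filter.Eventually.of_forall fun x => energyDensity_nonneg _ _ _)
    (Ioi_subset_Ioi ha).eventuallyLE

/-- Of the p factors, p - 2 are estimated by the sup bound `sq_le_two_mul_energy`, which leaves an
integrable square. -/
lemma rpow_abs_le (h : IsHalfLineSobolev f g) {p M : ℝ} (hp : 2 < p)
    (hM : halfLineEnergy f g ≤ M) {x : ℝ} (hx : 0 ≤ x) :
    |f x| ^ p ≤ (2 * M) ^ ((p - 2) / 2) * f x ^ 2 := by
  have h1 : |f x| ^ p = (f x ^ 2) ^ ((p - 2) / 2) * f x ^ 2 := by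
    rcases eq_or_ne (f x) 0 with h0 | h0
    · rw [h0, abs_zero, Real.zero_rpow (by linarith)]; simp
    · have hpos : 0 < |f x| := abs_pos.2 h0
      rw [← sq_abs, ← Real.rpow_natCast (|f x|) 2, ← Real.rpow_mul hpos.le,
        ← Real.rpow_add hpos]
      congr 1
      push_cast
      ring
  rw [h1]
  refine mul_le_mul_of_nonneg_right (Real.rpow_le_rpow (sq_nonneg _) ?_ (by linarith))
    (sq_nonneg _)
  exact (h.sq_le_two_mul_energy hx).trans (by linarith)

lemma integrableOn_rpow (h : IsHalfLineSobolev f g) {p : ℝ} (hp : 2 < p) :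
    IntegrableOn (fun x => |f x| ^ p) (Ioi 0) := by
  refine Integrable.mono' (h.memLp.integrable_sq.const_mul
    ((2 * halfLineEnergy f g) ^ ((p - 2) / 2))) ?_ ?_
  · exact ((h.memLp.aestronglyMeasurable.norm.aemeasurable.pow_const p)).aestronglyMeasurable
  · rw [ae_restrict_iff' measurableSet_Ioi]
    refine Filter.Eventually.of_forall fun x hx => ?_
    rw [Real.norm_of_nonneg (by positivity)]
    exact h.rpow_abs_le hp le_rfl (le_of_lt hx)

lemma halfLinePow_le (h : IsHalfLineSobolev f g) {p M : ℝ} (hp : 2 < p)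
    (hM : halfLineEnergy f g ≤ M) :
    halfLinePow p f ≤ (2 * M) ^ ((p - 2) / 2) * halfLineEnergy f g := by
  have hM0 : 0 ≤ M := (halfLineEnergy_nonneg f g).trans hM
  have h1 : halfLinePow p f ≤ ∫ x in Ioi 0, (2 * M) ^ ((p - 2) / 2) * energyDensity f g x := by
    refine setIntegral_mono_on (h.integrableOn_rpow hp)
      (h.integrableOn_energyDensity.const_mul _) measurableSet_Ioi fun x hx => ?_
    refine (h.rpow_abs_le hp hM (le_of_lt hx)).trans (mul_le_mul_of_nonneg_left ?_ (by positivity))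
    simp only [energyDensity, sq_abs]
    nlinarith [sq_nonneg (g x)]
  rwa [integral_const_mul] at h1

lemma eq_zero_of_halfLinePow_eq_zero (h : IsHalfLineSobolev f g) {p : ℝ} (hp : 2 < p)
    (h0 : halfLinePow p f = 0) {x : ℝ} (hx : 0 ≤ x) : f x = 0 := by
  have h1 : (fun x => |f x| ^ p) =ᵐ[volume.restrict (Ioi 0)] 0 :=
    (setIntegral_eq_zero_iff_of_nonneg_ae (Filter.Eventually.of_forall fun x => by positivity)
      (h.integrableOn_rpow hp)).1 h0
  have h2 : f =ᵐ[volume.restrict (Ioi 0)] fun _ => 0 := by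
    filter_upwards [h1] with y hy
    have := (Real.rpow_eq_zero (abs_nonneg (f y)) (by linarith)).1 hy
    exact abs_eq_zero.1 this
  have h3 : EqOn f (fun _ => 0) (Ioi 0) :=
    Measure.eqOn_open_of_ae_eq h2 isOpen_Ioi (h.continuousOn.mono Ioi_subset_Ici_self)
      continuousOn_const
  exact h3.of_subset_closure h.continuousOn continuousOn_const Ioi_subset_Ici_self
    (closure_Ioi (0 : ℝ)).ge hx

lemma halfLinePow_pos (h : IsHalfLineSobolev f g) {p : ℝ} (hp : 2 < p) {x : ℝ} (hx : 0 ≤ x)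
    (hfx : f x ≠ 0) : 0 < halfLinePow p f :=
  (halfLinePow_nonneg p f).lt_of_ne' fun h0 => hfx (h.eq_zero_of_halfLinePow_eq_zero hp h0 hx)

lemma halfLineEnergy_pos (h : IsHalfLineSobolev f g) {x : ℝ} (hx : 0 ≤ x)
    (hfx : f x ≠ 0) : 0 < halfLineEnergy f g := by
  have := h.sq_le_two_mul_energy hx
  have := pow_pos (abs_pos.2 hfx) 2
  rw [sq_abs] at this
  linarith

lemma zero : IsHalfLineSobolev (fun _ => 0) (fun _ => 0) :=
  ⟨MemLp.zero, MemLp.zero, by simp⟩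

lemma const_mul (h : IsHalfLineSobolev f g) (c : ℝ) :
    IsHalfLineSobolev (fun x => c * f x) (fun x => c * g x) :=
  ⟨h.memLp.const_mul c, h.memLp_deriv.const_mul c, fun x hx => by
    rw [intervalIntegral.integral_const_mul, h.eq_add_integral x hx, mul_add]⟩

end IsHalfLineSobolev

lemma halfLineEnergy_const_mul (f g : ℝ → ℝ) (c : ℝ) :
    halfLineEnergy (fun x => c * f x) (fun x => c * g x) = c ^ 2 * halfLineEnergy f g := by
  rw [halfLineEnergy, halfLineEnergy, ← integral_const_mul]
  congr 1 with x
  simp only [energyDensity, sq_abs]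
  ring

lemma halfLineEnergy_zero : halfLineEnergy (fun _ => 0) (fun _ => 0) = 0 := by
  simp [halfLineEnergy, energyDensity]

lemma halfLinePow_zero {p : ℝ} (hp : 2 < p) : halfLinePow p (fun _ => 0) = 0 := by
  simp [halfLinePow, Real.zero_rpow (by linarith : p ≠ 0)]

/-- The function `max (1 - x) 0` on the half-line. -/
lemma isHalfLineSobolev_ramp :
    IsHalfLineSobolev (fun x => max (1 - x) 0) ((Ioc 0 1).indicator fun _ => -1) := by
  have hc : Continuous fun x : ℝ => max (1 - x) 0 := by fun_prop
  refine ⟨?_, ?_, fun x hx => ?_⟩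
  · have h1 : MemLp (fun x : ℝ => max (1 - x) 0) 2 (volume.restrict (Ioc 0 1)) := by
      refine MemLp.of_bound hc.aestronglyMeasurable 1 ?_
      rw [ae_restrict_iff' measurableSet_Ioc]
      refine Filter.Eventually.of_forall fun x hx => ?_
      rw [Real.norm_of_nonneg (le_max_right _ _)]
      exact max_le (by linarith [hx.1]) zero_le_one
    have h2 : (fun x : ℝ => max (1 - x) 0) =ᵐ[volume.restrict (Ioi 0)]
        (Ioc 0 1).indicator fun x => max (1 - x) 0 := by
      rw [Filter.EventuallyEq, ae_restrict_iff' measurableSet_Ioi]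
      refine Filter.Eventually.of_forall fun x hx => ?_
      by_cases hx1 : x ≤ 1
      · rw [indicator_of_mem (show x ∈ Ioc (0:ℝ) 1 from ⟨hx, hx1⟩)]
      · rw [indicator_of_notMem (show x ∉ Ioc (0:ℝ) 1 from fun h => hx1 h.2)]
        exact max_eq_right (by linarith)
    exact (((memLp_indicator_iff_restrict measurableSet_Ioc).2 h1).restrict _).ae_eq h2.symm
  · have h1 : MemLp (fun _ : ℝ => (-1 : ℝ)) 2 (volume.restrict (Ioc (0 : ℝ) 1)) := memLp_const _
    exact ((memLp_indicator_iff_restrict measurableSet_Ioc).2 h1).restrict _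
  · rw [intervalIntegral.integral_of_le hx, setIntegral_indicator measurableSet_Ioc,
      Ioc_inter_Ioc]
    rcases le_total x 1 with h | h
    · simp [h, hx]
      ring
    · simp [h]

/-! ### Translations, reflections and splitting of integrals -/

lemma measurableEmbedding_const_add (t : ℝ) : MeasurableEmbedding fun x : ℝ => t + x :=
  (Homeomorph.addLeft t).measurableEmbedding

lemma measurableEmbedding_const_sub (t : ℝ) : MeasurableEmbedding fun x : ℝ => t - x :=
  (Homeomorph.subLeft t).measurableEmbedding

lemma measurePreserving_const_add_Ioi (t : ℝ) :
    MeasurePreserving (fun x : ℝ => t + x) (volume.restrict (Ioi 0)) (volume.restrict (Ioi t)) := by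
  have := (measurePreserving_add_left (volume : Measure ℝ) t).restrict_preimage_emb
    (measurableEmbedding_const_add t) (Ioi t)
  simpa using this

lemma measurePreserving_const_sub_Iio (t : ℝ) :
    MeasurePreserving (fun x : ℝ => t - x) (volume.restrict (Ioi 0)) (volume.restrict (Iio t)) := by
  have := (Measure.measurePreserving_sub_left (volume : Measure ℝ) t).restrict_preimage_emb
    (measurableEmbedding_const_sub t) (Iio t)
  simpa using this

lemma integral_comp_const_add_Ioi (F : ℝ → ℝ) (t : ℝ) :
    ∫ x in Ioi 0, F (t + x) = ∫ x in Ioi t, F x :=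
  (measurePreserving_const_add_Ioi t).integral_comp (measurableEmbedding_const_add t) F

/-- An integral over the line, split at `t` into two integrals over half-lines. -/
lemma integral_eq_add_integral_Ioi {F : ℝ → ℝ} (t : ℝ)
    (h₁ : IntegrableOn (fun x => F (t + x)) (Ioi 0))
    (h₂ : IntegrableOn (fun x => F (t - x)) (Ioi 0)) :
    ∫ x, F x = (∫ x in Ioi 0, F (t + x)) + ∫ x in Ioi 0, F (t - x) := by
  have h₁' : IntegrableOn F (Ioi t) :=
    ((measurePreserving_const_add_Ioi t).integrable_comp_emb (measurableEmbedding_const_add t)).1 h₁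
  have h₂' : IntegrableOn F (Iio t) :=
    ((measurePreserving_const_sub_Iio t).integrable_comp_emb (measurableEmbedding_const_sub t)).1 h₂
  rw [integral_comp_const_add_Ioi,
    (measurePreserving_const_sub_Iio t).integral_comp (measurableEmbedding_const_sub t) F,
    ← integral_Iic_eq_integral_Iio, add_comm, intervalIntegral.integral_Iic_add_Ioi _ h₁']
  rwa [integrableOn_Iic_iff_integrableOn_Iio]

lemma IsHalfLineSobolev.shift {f g : ℝ → ℝ} (h : IsHalfLineSobolev f g) {t : ℝ} (ht : 0 ≤ t) :
    IsHalfLineSobolev (fun x => f (t + x)) (fun x => g (t + x)) := by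
  have hm : volume.restrict (Ioi t) ≤ volume.restrict (Ioi (0 : ℝ)) :=
    Measure.restrict_mono (Ioi_subset_Ioi ht) le_rfl
  refine ⟨(h.memLp.mono_measure hm).comp_measurePreserving (measurePreserving_const_add_Ioi t),
    (h.memLp_deriv.mono_measure hm).comp_measurePreserving (measurePreserving_const_add_Ioi t),
    fun x hx => ?_⟩
  have := h.sub_eq_integral (a := t) (b := t + x) ht (by linarith)
  simp only [intervalIntegral.integral_comp_add_left, add_zero]
  linarith

lemma halfLineEnergy_shift {f g : ℝ → ℝ} {t : ℝ} :
    halfLineEnergy (fun x => f (t + x)) (fun x => g (t + x)) = ∫ x in Ioi t, energyDensity f g x :=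
  integral_comp_const_add_Ioi (energyDensity f g) t

lemma halfLinePow_shift {p : ℝ} {f : ℝ → ℝ} {t : ℝ} :
    halfLinePow p (fun x => f (t + x)) = ∫ x in Ioi t, |f x| ^ p :=
  integral_comp_const_add_Ioi (fun x => |f x| ^ p) t

lemma integral_Ioi_eq_add {F : ℝ → ℝ} {t : ℝ} (hF : IntegrableOn F (Ioi 0)) (ht : 0 ≤ t) :
    ∫ x in Ioi 0, F x = (∫ x in Ioc 0 t, F x) + ∫ x in Ioi t, F x := by
  rw [← Ioc_union_Ioi_eq_Ioi ht, setIntegral_union (Ioc_disjoint_Ioi le_rfl) measurableSet_Ioi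
    (hF.mono_set Ioc_subset_Ioi_self) (hF.mono_set (Ioi_subset_Ioi ht))]

/-! ### Cutting functions on the line and gluing functions on half-lines -/

section Line

variable {u u' : ℝ → ℝ}

lemma IsSobolevOn.sub_eq_integral_univ (h : IsSobolevOn univ u u') (hu : Continuous u) (a b : ℝ) :
    u b - u a = ∫ t in a..b, u' t := by
  have h2 : MemLp u' 2 := by simpa using h.memLp_deriv
  exact h.hasWeakDerivOn.sub_eq_integral ordConnected_univ isOpen_univ hu.continuousOn
    ((h2.locallyIntegrable (by norm_num)).locallyIntegrableOn _) (mem_univ a) (mem_univ b)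

lemma IsSobolevOn.isHalfLineSobolev_right (h : IsSobolevOn univ u u') (hu : Continuous u) (t : ℝ) :
    IsHalfLineSobolev (fun x => u (t + x)) (fun x => u' (t + x)) := by
  have h1 : MemLp u 2 := by simpa using h.memLp
  have h2 : MemLp u' 2 := by simpa using h.memLp_deriv
  refine ⟨(h1.restrict _).comp_measurePreserving (measurePreserving_const_add_Ioi t),
    (h2.restrict _).comp_measurePreserving (measurePreserving_const_add_Ioi t), fun x _ => ?_⟩
  have := h.sub_eq_integral_univ hu t (t + x)
  simp only [intervalIntegral.integral_comp_add_left, add_zero]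
  linarith

lemma IsSobolevOn.isHalfLineSobolev_left (h : IsSobolevOn univ u u') (hu : Continuous u) (t : ℝ) :
    IsHalfLineSobolev (fun x => u (t - x)) (fun x => -u' (t - x)) := by
  have h1 : MemLp u 2 := by simpa using h.memLp
  have h2 : MemLp u' 2 := by simpa using h.memLp_deriv
  refine ⟨(h1.restrict _).comp_measurePreserving (measurePreserving_const_sub_Iio t),
    ((h2.restrict _).comp_measurePreserving (measurePreserving_const_sub_Iio t)).neg,
    fun x _ => ?_⟩
  have := h.sub_eq_integral_univ hu (t - x) t
  simp only [intervalIntegral.integral_neg, intervalIntegral.integral_comp_sub_left, sub_zero]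
  linarith

lemma IsSobolevOn.integral_energy_eq (h : IsSobolevOn univ u u') (hu : Continuous u) (t : ℝ) :
    ∫ x, energyDensity u u' x = halfLineEnergy (fun x => u (t + x)) (fun x => u' (t + x))
      + halfLineEnergy (fun x => u (t - x)) (fun x => -u' (t - x)) := by
  have h2 := (h.isHalfLineSobolev_left hu t).integrableOn_energyDensity
  have he : energyDensity (fun x => u (t - x)) (fun x => -u' (t - x))
      = fun x => energyDensity u u' (t - x) := by
    ext x
    simp [energyDensity]
  rw [he] at h2
  rw [integral_eq_add_integral_Ioi t (h.isHalfLineSobolev_right hu t).integrableOn_energyDensity h2,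
    halfLineEnergy, halfLineEnergy, he]
  rfl

lemma IsSobolevOn.integral_rpow_eq (h : IsSobolevOn univ u u') (hu : Continuous u) {p : ℝ}
    (hp : 2 < p) (t : ℝ) :
    ∫ x, |u x| ^ p = halfLinePow p (fun x => u (t + x)) + halfLinePow p (fun x => u (t - x)) :=
  integral_eq_add_integral_Ioi (F := fun x => |u x| ^ p) t
    ((h.isHalfLineSobolev_right hu t).integrableOn_rpow hp)
    ((h.isHalfLineSobolev_left hu t).integrableOn_rpow hp)

end Line

/-- Two functions on half-lines with the same value at the end point form a function on the line. -/
lemma IsHalfLineSobolev.exists_glue {f₁ g₁ f₂ g₂ : ℝ → ℝ} (h₁ : IsHalfLineSobolev f₁ g₁)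
    (h₂ : IsHalfLineSobolev f₂ g₂) (h0 : f₁ 0 = f₂ 0) :
    ∃ u u' : ℝ → ℝ, Continuous u ∧ IsSobolevOn univ u u' ∧ (∀ x, 0 ≤ x → u x = f₁ x) ∧
      (∀ x, x ≤ 0 → u x = f₂ (-x)) ∧
      ∫ x, energyDensity u u' x = halfLineEnergy f₁ g₁ + halfLineEnergy f₂ g₂ ∧
      ∀ p, 2 < p → ∫ x, |u x| ^ p = halfLinePow p f₁ + halfLinePow p f₂ := by
  classical
  set u : ℝ → ℝ := (Ioi 0).piecewise f₁ (fun x => f₂ (-x)) with hu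
  set u' : ℝ → ℝ := (Ioi 0).piecewise g₁ (fun x => -g₂ (-x)) with hu'
  have hmp : MeasurePreserving (fun x : ℝ => -x) (volume.restrict (Ioi 0)ᶜ)
      (volume.restrict (Ioi 0)) := by
    have := (Measure.measurePreserving_neg (volume : Measure ℝ)).restrict_preimage_emb
      (Homeomorph.neg ℝ).measurableEmbedding (Ioi 0)
    rw [compl_Ioi, Measure.restrict_congr_set (Iio_ae_eq_Iic (a := (0 : ℝ))).symm]
    simpa using this
  have hmu : MemLp u 2 := MemLp.piecewise measurableSet_Ioi h₁.memLp
    (h₂.memLp.comp_measurePreserving hmp)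
  have hmu' : MemLp u' 2 := MemLp.piecewise measurableSet_Ioi h₁.memLp_deriv
    (h₂.memLp_deriv.comp_measurePreserving hmp).neg
  have hright : ∀ x, 0 ≤ x → u x = f₁ x := by
    intro x hx
    rcases hx.eq_or_lt with rfl | hx
    · simp [hu, h0]
    · exact piecewise_eq_of_mem _ _ _ hx
  have hleft : ∀ x, x ≤ 0 → u x = f₂ (-x) := fun x hx => piecewise_eq_of_notMem _ _ _ hx.not_gt
  have hright' : ∀ x, 0 < x → u' x = g₁ x := fun x hx => piecewise_eq_of_mem _ _ _ hx
  have hleft' : ∀ x, x ≤ 0 → u' x = -g₂ (-x) := fun x hx => piecewise_eq_of_notMem _ _ _ hx.not_gt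
  have hii : ∀ c d, IntervalIntegrable u' volume c d := fun c d =>
    ((hmu'.locallyIntegrable (by norm_num)).integrableOn_isCompact isCompact_uIcc).intervalIntegrable
  -- This one identity yields both the continuity of `u` and its weak derivative. The negative side
  -- reduces to `f₂` by reflection.
  have hftc : ∀ x, u x = u 0 + ∫ t in 0..x, u' t := by
    intro x
    rw [hright 0 le_rfl]
    rcases le_total 0 x with hx | hx
    · rw [hright x hx, h₁.eq_add_integral x hx, intervalIntegral.integral_of_le hx,
        intervalIntegral.integral_of_le hx,
        setIntegral_congr_fun measurableSet_Ioc fun t ht => hright' t ht.1]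
    · have h3 : ∫ t in x..0, u' t = ∫ t in x..0, -g₂ (-t) := by
        refine intervalIntegral.integral_congr fun t ht => hleft' t ?_
        rw [uIcc_of_le hx] at ht
        exact ht.2
      rw [hleft x hx, h₂.eq_add_integral (-x) (by linarith), intervalIntegral.integral_symm x 0, h3,
        intervalIntegral.integral_neg, intervalIntegral.integral_comp_neg (fun t => g₂ t), h0]
      simp
  have hcont : Continuous u := by
    have : Continuous fun x => u 0 + ∫ t in 0..x, u' t :=
      continuous_const.add (intervalIntegral.continuous_primitive hii 0)
    exact this.congr fun x => (hftc x).symm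
  have hsob : IsSobolevOn univ u u' :=
    ⟨by simpa using hmu, by simpa using hmu', hasWeakDerivOn_of_forall_eq_add_integral hii hftc⟩
  refine ⟨u, u', hcont, hsob, hright, hleft, ?_, fun p hp => ?_⟩
  · rw [hsob.integral_energy_eq hcont 0]
    congr 1
    · refine setIntegral_congr_fun measurableSet_Ioi fun x hx => ?_
      simp only [energyDensity, zero_add]
      rw [hright x (le_of_lt hx), hright' x hx]
    · refine setIntegral_congr_fun measurableSet_Ioi fun x hx => ?_
      simp only [energyDensity, zero_sub]
      rw [hleft _ (neg_nonpos.2 (le_of_lt hx)), hleft' _ (neg_nonpos.2 (le_of_lt hx)), neg_neg,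
        neg_neg]
  · rw [hsob.integral_rpow_eq hcont hp 0]
    congr 1
    · refine setIntegral_congr_fun measurableSet_Ioi fun x hx => ?_
      simp only [zero_add]
      rw [hright x (le_of_lt hx)]
    · refine setIntegral_congr_fun measurableSet_Ioi fun x hx => ?_
      simp only [zero_sub]
      rw [hleft _ (neg_nonpos.2 (le_of_lt hx)), neg_neg]

/-! ### The constant of the line as a constant for pairs -/

/-- `C` is admissible in the Sobolev inequality for pairs of functions on the half-line that agree
at the end point. -/
def IsPairConstant (p C : ℝ) : Prop :=
  ∀ f₁ g₁ f₂ g₂ : ℝ → ℝ, IsHalfLineSobolev f₁ g₁ → IsHalfLineSobolev f₂ g₂ → f₁ 0 = f₂ 0 →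
    (halfLinePow p f₁ + halfLinePow p f₂) ^ (2 / p)
      ≤ C * (halfLineEnergy f₁ g₁ + halfLineEnergy f₂ g₂)

/-- Cutting at 0 and gluing at 0 are inverse operations that preserve total energy and power. -/
lemma isPairConstant_iff {p C : ℝ} (hp : 2 < p) :
    IsPairConstant p C ↔ ∀ v v' : ℝ → ℝ, Continuous v → IsSobolevOn univ v v' →
      (∫ x, |v x| ^ p) ^ (2 / p) ≤ C * ∫ x, (|v' x| ^ 2 + |v x| ^ 2) := by
  constructor
  · intro h v v' hv hs
    have h1 := h _ _ _ _ (hs.isHalfLineSobolev_right hv 0) (hs.isHalfLineSobolev_left hv 0) (by simp)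
    rw [← hs.integral_rpow_eq hv hp, ← hs.integral_energy_eq hv] at h1
    exact h1
  · intro h f₁ g₁ f₂ g₂ h₁ h₂ h0
    obtain ⟨u, u', hu, hs, -, -, hE, hA⟩ := h₁.exists_glue h₂ h0
    rw [← hA p hp, ← hE]
    exact h u u' hu hs

/-- With `E` the total energy, the sup bound `f ^ 2 ≤ 2 * E` gives a total power of at most `(2 * E)
^ (p / 2)`. -/
lemma isPairConstant_two {p : ℝ} (hp : 2 < p) : IsPairConstant p 2 := by
  intro f₁ g₁ f₂ g₂ h₁ h₂ _
  have hE1 := halfLineEnergy_nonneg f₁ g₁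
  have hE2 := halfLineEnergy_nonneg f₂ g₂
  set E := halfLineEnergy f₁ g₁ + halfLineEnergy f₂ g₂ with hE
  have hE0 : 0 ≤ E := by positivity
  have hA1 := h₁.halfLinePow_le hp (M := E) (by linarith)
  have hA2 := h₂.halfLinePow_le hp (M := E) (by linarith)
  have hle : halfLinePow p f₁ + halfLinePow p f₂ ≤ (2 * E) ^ (p / 2) := by
    have h3 : (2 * E) ^ (p / 2) = (2 * E) ^ ((p - 2) / 2) * (2 * E) := by
      have h5 : p / 2 = (p - 2) / 2 + 1 := by ring
      rw [h5, Real.rpow_add_one' (by positivity) (by linarith)]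
    have h4 : 0 ≤ (2 * E) ^ ((p - 2) / 2) := by positivity
    rw [h3]
    nlinarith
  calc (halfLinePow p f₁ + halfLinePow p f₂) ^ (2 / p)
      ≤ ((2 * E) ^ (p / 2)) ^ (2 / p) := by
        refine Real.rpow_le_rpow (add_nonneg (halfLinePow_nonneg _ _) (halfLinePow_nonneg _ _)) hle ?_
        have : 0 < p := by linarith
        positivity
    _ = 2 * E := by
        rw [← Real.rpow_mul (by positivity)]
        have : p ≠ 0 := by linarith
        rw [show p / 2 * (2 / p) = 1 by field_simp, Real.rpow_one]

/-- The ratio for a single non-zero pair, the ramp with itself, bounds all admissible constants from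
below. -/
lemma exists_pos_le_of_isPairConstant {p : ℝ} (hp : 2 < p) :
    ∃ c > 0, ∀ C, IsPairConstant p C → c ≤ C := by
  have h := isHalfLineSobolev_ramp
  have h1 : (fun x : ℝ => max (1 - x) 0) 0 ≠ 0 := by simp
  have hA := h.halfLinePow_pos hp le_rfl h1
  have hE := h.halfLineEnergy_pos le_rfl h1
  refine ⟨_, div_pos (Real.rpow_pos_of_pos (add_pos hA hA) (2 / p)) (add_pos hE hE), fun C hC => ?_⟩
  rw [div_le_iff₀ (add_pos hE hE)]
  exact hC _ _ _ _ h h rfl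

/-- For positive energy, admissibility is a lower bound on `C` by a fixed ratio, and it survives the
infimum. For zero energy the constant 2 shows that the left side vanishes. -/
lemma isPairConstant_sInf {p : ℝ} (hp : 2 < p) :
    IsPairConstant p (sInf {C | IsPairConstant p C}) := by
  intro f₁ g₁ f₂ g₂ h₁ h₂ h0
  have hE1 := halfLineEnergy_nonneg f₁ g₁
  have hE2 := halfLineEnergy_nonneg f₂ g₂
  rcases (add_nonneg hE1 hE2).eq_or_lt with hE | hE
  · have := isPairConstant_two hp _ _ _ _ h₁ h₂ h0
    rw [← hE] at this ⊢
    simpa using this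
  · rw [← div_le_iff₀ hE]
    refine le_csInf ⟨2, isPairConstant_two hp⟩ fun C hC => ?_
    rw [div_le_iff₀ hE]
    exact hC _ _ _ _ h₁ h₂ h0

/-- As `sInf ∅ = 0` in ℝ, strict positivity also excludes the default value, so the constant is a
genuine finite infimum. -/
lemma sInf_isPairConstant_pos {p : ℝ} (hp : 2 < p) : 0 < sInf {C | IsPairConstant p C} := by
  obtain ⟨c, hc, h⟩ := exists_pos_le_of_isPairConstant hp
  exact hc.trans_le (h _ (isPairConstant_sInf hp))

lemma IsPairConstant.nonneg {p C : ℝ} (hp : 2 < p) (h : IsPairConstant p C) : 0 ≤ C := by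
  obtain ⟨c, hc, hle⟩ := exists_pos_le_of_isPairConstant hp
  exact hc.le.trans (hle C h)

/-! ### Rigidity of extremals that vanish at the end point -/

/-- A near optimal function on the half-line that vanishes at `0` vanishes near `0`, in a
neighbourhood that depends on the energy and on the power integral only. -/
lemma IsPairConstant.exists_forall_eq_zero {p C : ℝ} (hp : 2 < p) (hC : IsPairConstant p C)
    (hC0 : 0 < C) {A M : ℝ} (hA : 0 < A) :
    ∃ δ > 0, ∀ f g : ℝ → ℝ, IsHalfLineSobolev f g → f 0 = 0 → halfLineEnergy f g ≤ M →
      halfLinePow p f = A → C * halfLineEnergy f g ≤ A ^ (2 / p) → ∀ x ∈ Icc 0 δ, f x = 0 := by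
  set r : ℝ → ℝ := fun x => max (1 - x) 0 with hr
  set r' : ℝ → ℝ := (Ioc 0 1).indicator fun _ => -1 with hr'
  have hramp : IsHalfLineSobolev r r' := isHalfLineSobolev_ramp
  set K := halfLineEnergy r r' with hK
  have hK0 : 0 ≤ K := halfLineEnergy_nonneg _ _
  set B := (2 * max M 0) ^ ((p - 2) / 2) with hB
  have hB0 : 0 ≤ B := by positivity
  set Q := A ^ (2 / p) / A with hQ
  have hQ0 : 0 ≤ Q := by positivity
  -- The second bound keeps the energy of the new ramp below `D / 4`, the third the loss in the
  -- power term below `C / 4 * D`; the summands `+ 1` avoid division by zero.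
  set δ := min 1 (min (1 / (4 * (K + 1))) (C / (4 * (Q * B + 1)))) with hδ
  have hδ0 : 0 < δ := by positivity
  have hδ1 : δ ≤ 1 := min_le_left _ _
  have hδK : K * δ ≤ 1 / 4 := by
    have h1 : δ ≤ 1 / (4 * (K + 1)) := (min_le_right _ _).trans (min_le_left _ _)
    rw [le_div_iff₀ (by positivity)] at h1
    nlinarith
  have hδQ : Q * B * δ ≤ C / 4 := by
    have h1 : δ ≤ C / (4 * (Q * B + 1)) := (min_le_right _ _).trans (min_le_right _ _)
    rw [le_div_iff₀ (by positivity)] at h1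
    nlinarith
  refine ⟨δ, hδ0, fun f g h h0 hM hfA hle => ?_⟩
  set D := ∫ x in Ioc 0 δ, energyDensity f g x with hD
  have hD0 : 0 ≤ D := integral_nonneg fun x => energyDensity_nonneg _ _ _
  have hsq : ∀ x ∈ Icc 0 δ, f x ^ 2 ≤ δ * D := by
    intro x hx
    have h1 := h.sq_sub_le le_rfl hx.1
    rw [h0, sub_zero, sub_zero] at h1
    have h2 := h.setIntegral_sq_deriv_le le_rfl (Ioc_subset_Ioc_right hx.2)
      (t := Ioc 0 δ) Ioc_subset_Ioi_self measurableSet_Ioc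
    have h3 : 0 ≤ ∫ x in Ioc 0 x, g x ^ 2 := integral_nonneg fun x => sq_nonneg _
    exact h1.trans (mul_le_mul hx.2 h2 h3 hδ0.le)
  have hEsplit := integral_Ioi_eq_add h.integrableOn_energyDensity hδ0.le
  have hAsplit := integral_Ioi_eq_add (h.integrableOn_rpow hp) hδ0.le
  set a := ∫ x in Ioc 0 δ, |f x| ^ p with ha
  have ha0 : 0 ≤ a := integral_nonneg fun x => by positivity
  have haB : a ≤ B * δ ^ 2 * D := by
    have h1 : a ≤ ∫ _ in Ioc 0 δ, B * (δ * D) := by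
      refine setIntegral_mono_on ((h.integrableOn_rpow hp).mono_set Ioc_subset_Ioi_self)
        (integrable_const _) measurableSet_Ioc fun x hx => ?_
      exact (h.rpow_abs_le hp (hM.trans (le_max_left M 0)) hx.1.le).trans
        (mul_le_mul_of_nonneg_left (hsq x (Ioc_subset_Icc_self hx)) hB0)
    have h2 : ∫ _ in Ioc 0 δ, B * (δ * D) = δ * (B * (δ * D)) := by
      simp [measureReal_def, hδ0.le]
    rw [h2] at h1
    linarith [h1, show δ * (B * (δ * D)) = B * δ ^ 2 * D by ring]
  -- The competitor keeps `f` beyond `δ` and replaces its part on `[0, δ]` by a ramp of height `f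
  -- δ`, glued at `δ`.
  have hpair := hC _ _ _ _ (h.shift hδ0.le) (hramp.const_mul (f δ)) (by simp [hr])
  rw [halfLineEnergy_shift, halfLinePow_shift, halfLineEnergy_const_mul, ← hK] at hpair
  have hE' : ∫ x in Ioi δ, energyDensity f g x = halfLineEnergy f g - D := by
    rw [halfLineEnergy, hEsplit]; ring
  have hA' : ∫ x in Ioi δ, |f x| ^ p = A - a := by
    rw [← hfA, halfLinePow, hAsplit]; ring
  have hA'0 : 0 ≤ A - a := hA' ▸ integral_nonneg fun x => by positivity
  rw [hE', hA'] at hpair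
  have hp0 : 0 < p := by linarith
  -- Chord bound for the concave power: removing mass `a` costs at most `a` times the slope `Q = A ^
  -- (2 / p) / A`.
  have hlow : A ^ (2 / p) - Q * a ≤ (A - a) ^ (2 / p) := by
    have hs0 : 0 ≤ (A - a) / A := by positivity
    have hs1 : (A - a) / A ≤ 1 := by rw [div_le_one hA]; linarith
    have h1 : (A - a) ^ (2 / p) = A ^ (2 / p) * ((A - a) / A) ^ (2 / p) := by
      rw [← Real.mul_rpow hA.le hs0, mul_div_cancel₀ _ hA.ne']
    have h2 : (A - a) / A ≤ ((A - a) / A) ^ (2 / p) :=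
      Real.self_le_rpow_of_le_one hs0 hs1 (by rw [div_le_one hp0]; exact hp.le)
    have h3 : A ^ (2 / p) * ((A - a) / A) = A ^ (2 / p) - Q * a := by
      rw [hQ]; field_simp
    rw [h1, ← h3]
    exact mul_le_mul_of_nonneg_left h2 (by positivity)
  have hmono : (A - a) ^ (2 / p) ≤ (A - a + halfLinePow p fun x => f δ * r x) ^ (2 / p) :=
    Real.rpow_le_rpow hA'0 (le_add_of_nonneg_right (halfLinePow_nonneg _ _)) (by positivity)
  have hfδ := hsq δ (right_mem_Icc.2 hδ0.le)
  -- The competitor inequality and near optimality combine to `C * D ≤ C * (f δ ^ 2 * K) + Q * a`,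
  -- and each term on the right is at most `C / 4 * D`.
  have hkey : C * D ≤ C / 4 * D + C / 4 * D := by
    have h1 : f δ ^ 2 * K ≤ D / 4 := by
      have : f δ ^ 2 * K ≤ δ * D * K := mul_le_mul_of_nonneg_right hfδ hK0
      nlinarith
    have h2 : C * (f δ ^ 2 * K) ≤ C * (D / 4) := mul_le_mul_of_nonneg_left h1 hC0.le
    have h3 : Q * a ≤ C / 4 * D := by
      calc Q * a ≤ Q * (B * δ ^ 2 * D) := mul_le_mul_of_nonneg_left haB hQ0
        _ = Q * B * δ * (δ * D) := by ring
        _ ≤ C / 4 * (1 * D) := by gcongr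
        _ = C / 4 * D := by ring
    nlinarith
  have hDz : D = 0 := by nlinarith
  intro x hx
  have := hsq x hx
  rw [hDz, mul_zero] at this
  exact pow_eq_zero_iff two_ne_zero |>.1 (le_antisymm this (sq_nonneg _))

/-- An optimal function on the half-line that vanishes at the end point is zero. -/
lemma IsPairConstant.halfLinePow_eq_zero {p C : ℝ} (hp : 2 < p) (hC : IsPairConstant p C)
    (hC0 : 0 < C) {f g : ℝ → ℝ} (h : IsHalfLineSobolev f g) (h0 : f 0 = 0)
    (hle : C * halfLineEnergy f g ≤ halfLinePow p f ^ (2 / p)) : halfLinePow p f = 0 := by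
  by_contra hne
  have hA : 0 < halfLinePow p f := (halfLinePow_nonneg p f).lt_of_ne' hne
  obtain ⟨δ, hδ, key⟩ := hC.exists_forall_eq_zero hp hC0 (M := halfLineEnergy f g) hA
  -- Dropping a stretch where `f` vanishes keeps the power and does not raise the energy, so the
  -- same `δ` serves at every step.
  have hind : ∀ n : ℕ, ∀ x ∈ Icc 0 (n * δ), f x = 0 := by
    intro n
    induction n with
    | zero =>
      intro x hx
      have hx0 : x = 0 := le_antisymm (by simpa using hx.2) hx.1
      rw [hx0, h0]
    | succ n ih =>
      have ht : 0 ≤ n * δ := by positivity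
      have hE : halfLineEnergy (fun x => f (n * δ + x)) (fun x => g (n * δ + x))
          ≤ halfLineEnergy f g := by
        rw [halfLineEnergy_shift]
        exact setIntegral_mono_set h.integrableOn_energyDensity
          (Filter.Eventually.of_forall fun x => energyDensity_nonneg _ _ _)
          (Ioi_subset_Ioi ht).eventuallyLE
      have hAz : halfLinePow p (fun x => f (n * δ + x)) = halfLinePow p f := by
        have hz : ∫ x in Ioc 0 (n * δ), |f x| ^ p = 0 :=
          setIntegral_eq_zero_of_forall_eq_zero fun x hx => by
            rw [ih x (Ioc_subset_Icc_self hx), abs_zero, Real.zero_rpow (by linarith)]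
        rw [halfLinePow_shift, halfLinePow, integral_Ioi_eq_add (h.integrableOn_rpow hp) ht, hz,
          zero_add]
      have hk := key _ _ (h.shift ht) (by simpa using ih (n * δ) (right_mem_Icc.2 ht)) hE hAz
        ((mul_le_mul_of_nonneg_left hE hC0.le).trans hle)
      intro x hx
      rcases le_total x (n * δ) with hx' | hx'
      · exact ih x ⟨hx.1, hx'⟩
      · have h1 := hx.2
        push_cast at h1
        have := hk (x - n * δ) ⟨by linarith, by linarith⟩
        simpa using this
  refine hne (setIntegral_eq_zero_of_forall_eq_zero fun x hx => ?_)
  obtain ⟨n, hn⟩ := exists_nat_ge (x / δ)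
  rw [hind n x ⟨le_of_lt hx, (div_le_iff₀ hδ).1 hn⟩, abs_zero, Real.zero_rpow (by linarith)]

/-- An optimal pair is zero if one of its members vanishes far out. -/
lemma IsPairConstant.halfLinePow_add_eq_zero {p C : ℝ} (hp : 2 < p) (hC : IsPairConstant p C)
    (hC0 : 0 < C) {f₁ g₁ f₂ g₂ : ℝ → ℝ} (h₁ : IsHalfLineSobolev f₁ g₁)
    (h₂ : IsHalfLineSobolev f₂ g₂) (h0 : f₁ 0 = f₂ 0) {L : ℝ} (hL : 0 ≤ L)
    (hz : ∀ x, L ≤ x → f₂ x = 0)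
    (hle : C * (halfLineEnergy f₁ g₁ + halfLineEnergy f₂ g₂)
      ≤ (halfLinePow p f₁ + halfLinePow p f₂) ^ (2 / p)) :
    halfLinePow p f₁ + halfLinePow p f₂ = 0 := by
  obtain ⟨u, u', hu, hs, -, hleft, hE, hA⟩ := h₁.exists_glue h₂ h0
  -- Splitting the glued function at `-L` instead of 0 leaves nothing on the left and a function
  -- vanishing at the end point on the right.
  rw [← hA p hp, ← hE, hs.integral_energy_eq hu (-L), hs.integral_rpow_eq hu hp (-L)] at hle
  rw [← hA p hp, hs.integral_rpow_eq hu hp (-L)]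
  have hz' : halfLinePow p (fun x => u (-L - x)) = 0 := by
    refine setIntegral_eq_zero_of_forall_eq_zero fun x hx => ?_
    have hx0 : (0 : ℝ) < x := hx
    simp only
    rw [hleft _ (by linarith), hz _ (by linarith), abs_zero, Real.zero_rpow (by linarith)]
  rw [hz', add_zero] at hle ⊢
  refine hC.halfLinePow_eq_zero hp hC0 (hs.isHalfLineSobolev_right hu (-L)) ?_
    (le_trans ?_ hle)
  · simp only [add_zero]
    rw [hleft _ (by linarith), neg_neg, hz L le_rfl]
  · exact mul_le_mul_of_nonneg_left (le_add_of_nonneg_right (halfLineEnergy_nonneg _ _)) hC0.le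

/-! ### Several half-lines with a common end point -/

lemma mul_div_le_rpow {p S s : ℝ} (hp : 2 < p) (hS : 0 < S) (hs : 0 ≤ s) (hsS : s ≤ S) :
    S ^ (2 / p) * (s / S) ≤ s ^ (2 / p) := by
  have hp0 : 0 < p := by linarith
  have h1 : s ^ (2 / p) = S ^ (2 / p) * (s / S) ^ (2 / p) := by
    rw [← Real.mul_rpow hS.le (by positivity), mul_div_cancel₀ _ hS.ne']
  rw [h1]
  -- The chord bound, scaled to `t ≤ t ^ (2 / p)` on `[0, 1]`.
  exact mul_le_mul_of_nonneg_left (Real.self_le_rpow_of_le_one (by positivity)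
    (by rwa [div_le_one hS]) (by rw [div_le_one hp0]; exact hp.le)) (by positivity)

/-- The chord bound is strict inside the interval because 2/p < 1; this is what detects the case of
equality. -/
lemma mul_div_lt_rpow {p S s : ℝ} (hp : 2 < p) (hs : 0 < s) (hsS : s < S) :
    S ^ (2 / p) * (s / S) < s ^ (2 / p) := by
  have hp0 : 0 < p := by linarith
  have hS : 0 < S := hs.trans hsS
  have h1 : s ^ (2 / p) = S ^ (2 / p) * (s / S) ^ (2 / p) := by
    rw [← Real.mul_rpow hS.le (by positivity), mul_div_cancel₀ _ hS.ne']
  rw [h1]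
  exact mul_lt_mul_of_pos_left (Real.self_lt_rpow_of_lt_one (by positivity)
    (by rwa [div_lt_one hS]) (by rw [div_lt_one hp0]; exact hp)) (by positivity)

/-- Among ordered pairs of distinct indices, each index occurs once in each position with each of
the others. The count is the full product minus the diagonal. -/
lemma sum_offDiag_add {κ : Type*} [Fintype κ] [DecidableEq κ] (x : κ → ℝ) :
    ∑ q ∈ (Finset.univ : Finset κ).offDiag, (x q.1 + x q.2)
      = 2 * (Fintype.card κ - 1) * ∑ k, x k := by
  have h1 : ∑ q ∈ (Finset.univ : Finset κ).diag, (x q.1 + x q.2)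
      + ∑ q ∈ (Finset.univ : Finset κ).offDiag, (x q.1 + x q.2)
      = ∑ q : κ × κ, (x q.1 + x q.2) := by
    rw [← Finset.sum_union (Finset.disjoint_diag_offDiag _), Finset.diag_union_offDiag,
      Finset.univ_product_univ]
  have h2 : ∑ q : κ × κ, (x q.1 + x q.2) = 2 * Fintype.card κ * ∑ k, x k := by
    simp only [Fintype.sum_prod_type, Finset.sum_add_distrib, Finset.sum_const, Finset.card_univ,
      nsmul_eq_mul, ← Finset.mul_sum]
    ring
  have h3 : ∑ q ∈ (Finset.univ : Finset κ).diag, (x q.1 + x q.2) = 2 * ∑ k, x k := by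
    rw [Finset.sum_diag, Finset.sum_add_distrib]
    ring
  linarith

section Star

variable {κ : Type*} [Fintype κ] {p C : ℝ} {F G : κ → ℝ → ℝ}

/-- The Sobolev inequality for at least two half-lines with a common end point. -/
lemma IsPairConstant.sum_rpow_le (hp : 2 < p) (hC : IsPairConstant p C)
    (h : ∀ k, IsHalfLineSobolev (F k) (G k)) (h0 : ∀ i j, F i 0 = F j 0)
    (hκ : 2 ≤ Fintype.card κ) :
    (∑ k, halfLinePow p (F k)) ^ (2 / p) ≤ C * ∑ k, halfLineEnergy (F k) (G k) := by
  classical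
  have hp0 : 0 < p := by linarith
  have hA : ∀ k, 0 ≤ halfLinePow p (F k) := fun k => halfLinePow_nonneg p _
  set S := ∑ k, halfLinePow p (F k) with hS
  have hSnn : 0 ≤ S := Finset.sum_nonneg fun k _ => hA k
  rcases hSnn.eq_or_lt with hS0 | hS0
  · rw [← hS0, Real.zero_rpow (by positivity)]
    exact mul_nonneg (hC.nonneg hp) (Finset.sum_nonneg fun k _ => halfLineEnergy_nonneg _ _)
  have hκ' : (2 : ℝ) ≤ Fintype.card κ := by exact_mod_cast hκ
  have h1 : ∑ q ∈ (Finset.univ : Finset κ).offDiag,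
      S ^ (2 / p) * ((halfLinePow p (F q.1) + halfLinePow p (F q.2)) / S)
      = 2 * (Fintype.card κ - 1) * S ^ (2 / p) := by
    rw [← Finset.mul_sum, ← Finset.sum_div, sum_offDiag_add (fun k => halfLinePow p (F k)), ← hS]
    field_simp
  have h2 : ∑ q ∈ (Finset.univ : Finset κ).offDiag,
      C * (halfLineEnergy (F q.1) (G q.1) + halfLineEnergy (F q.2) (G q.2))
      = 2 * (Fintype.card κ - 1) * (C * ∑ k, halfLineEnergy (F k) (G k)) := by
    rw [← Finset.mul_sum, sum_offDiag_add (fun k => halfLineEnergy (F k) (G k))]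
    ring
  have h3 : 2 * ((Fintype.card κ : ℝ) - 1) * S ^ (2 / p)
      ≤ 2 * (Fintype.card κ - 1) * (C * ∑ k, halfLineEnergy (F k) (G k)) := by
    rw [← h1, ← h2]
    -- For each pair: the chord bound, then the pair inequality.
    refine Finset.sum_le_sum fun q hq => ?_
    rw [Finset.mem_offDiag] at hq
    refine (mul_div_le_rpow hp hS0 (add_nonneg (hA _) (hA _)) ?_).trans
      (hC _ _ _ _ (h q.1) (h q.2) (h0 _ _))
    rw [hS, ← Finset.sum_pair (f := fun k => halfLinePow p (F k)) hq.2.2]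
    exact Finset.sum_le_sum_of_subset_of_nonneg (Finset.subset_univ _) fun k _ _ => hA k
  exact le_of_mul_le_mul_left h3 (by linarith)

/-- In the case of equality for at least three half-lines, only one of them matters. -/
lemma IsPairConstant.exists_forall_ne_halfLinePow_eq_zero (hp : 2 < p) (hC : IsPairConstant p C)
    (h : ∀ k, IsHalfLineSobolev (F k) (G k)) (h0 : ∀ i j, F i 0 = F j 0)
    (hκ : 3 ≤ Fintype.card κ) (hS0 : 0 < ∑ k, halfLinePow p (F k))
    (hle : C * ∑ k, halfLineEnergy (F k) (G k) ≤ (∑ k, halfLinePow p (F k)) ^ (2 / p)) :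
    ∃ i, ∀ j, j ≠ i → halfLinePow p (F j) = 0 := by
  classical
  have hA : ∀ k, 0 ≤ halfLinePow p (F k) := fun k => halfLinePow_nonneg p _
  set S := ∑ k, halfLinePow p (F k) with hS
  have hκ' : (3 : ℝ) ≤ Fintype.card κ := by exact_mod_cast hκ
  have h1 : ∑ q ∈ (Finset.univ : Finset κ).offDiag,
      S ^ (2 / p) * ((halfLinePow p (F q.1) + halfLinePow p (F q.2)) / S)
      = 2 * (Fintype.card κ - 1) * S ^ (2 / p) := by
    rw [← Finset.mul_sum, ← Finset.sum_div, sum_offDiag_add (fun k => halfLinePow p (F k)), ← hS]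
    field_simp
  have h2 : ∑ q ∈ (Finset.univ : Finset κ).offDiag,
      C * (halfLineEnergy (F q.1) (G q.1) + halfLineEnergy (F q.2) (G q.2))
      = 2 * (Fintype.card κ - 1) * (C * ∑ k, halfLineEnergy (F k) (G k)) := by
    rw [← Finset.mul_sum, sum_offDiag_add (fun k => halfLineEnergy (F k) (G k))]
    ring
  have hpairS : ∀ i j, i ≠ j → halfLinePow p (F i) + halfLinePow p (F j) ≤ S := fun i j hij => by
    rw [hS, ← Finset.sum_pair (f := fun k => halfLinePow p (F k)) hij]
    exact Finset.sum_le_sum_of_subset_of_nonneg (Finset.subset_univ _) fun k _ _ => hA k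
  -- A pair with positive power below `S` would make the summed inequality strict, against the
  -- assumed equality.
  have hdich : ∀ i j, i ≠ j → 0 < halfLinePow p (F i) →
      halfLinePow p (F i) + halfLinePow p (F j) = S := by
    intro i j hij hi
    by_contra hne
    have hlt := lt_of_le_of_ne (hpairS i j hij) hne
    have h3 : 2 * ((Fintype.card κ : ℝ) - 1) * S ^ (2 / p)
        < 2 * (Fintype.card κ - 1) * (C * ∑ k, halfLineEnergy (F k) (G k)) := by
      rw [← h1, ← h2]
      refine Finset.sum_lt_sum (fun q hq => ?_) ⟨(i, j), by simp [hij], ?_⟩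
      · rw [Finset.mem_offDiag] at hq
        exact (mul_div_le_rpow hp hS0 (add_nonneg (hA _) (hA _)) (hpairS _ _ hq.2.2)).trans
          (hC _ _ _ _ (h q.1) (h q.2) (h0 _ _))
      · exact (mul_div_lt_rpow hp (add_pos_of_pos_of_nonneg hi (hA j)) hlt).trans_le
          (hC _ _ _ _ (h i) (h j) (h0 _ _))
    exact absurd (lt_of_mul_lt_mul_left h3 (by linarith)) hle.not_gt
  obtain ⟨i, -, hi⟩ := Finset.exists_lt_of_sum_lt (s := Finset.univ) (f := fun _ : κ => (0 : ℝ))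
    (g := fun k => halfLinePow p (F k)) (by simpa using hS0)
  refine ⟨i, fun j hj => ?_⟩
  by_contra hjne
  have hjpos : 0 < halfLinePow p (F j) := (hA j).lt_of_ne' hjne
  -- If both `i` and `j` carry power, the three pairs among `i`, `j`, `m` each carry all of `S`, so
  -- together the three edges carry 3S/2 > S.
  obtain ⟨m, hm⟩ : ∃ m, m ∉ ({i, j} : Finset κ) := by
    by_contra! hall
    have : Fintype.card κ ≤ 2 := by
      rw [← Finset.card_univ]
      exact (Finset.card_le_card fun k _ => hall k).trans Finset.card_le_two
    omega
  simp only [Finset.mem_insert, Finset.mem_singleton, not_or] at hm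
  have e1 := hdich i j (Ne.symm hj) hi
  have e2 := hdich i m (Ne.symm hm.1) hi
  have e3 := hdich j m (Ne.symm hm.2) hjpos
  have : halfLinePow p (F i) + halfLinePow p (F j) + halfLinePow p (F m) ≤ S := by
    rw [hS]
    have h4 : ∑ k ∈ ({m, i, j} : Finset κ), halfLinePow p (F k) ≤ ∑ k, halfLinePow p (F k) :=
      Finset.sum_le_sum_of_subset_of_nonneg (Finset.subset_univ _) fun k _ _ => hA k
    rw [Finset.sum_insert (by simp [hm.1, hm.2]), Finset.sum_pair (Ne.symm hj)] at h4
    linarith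
  linarith

end Star

/-! ### From functions vanishing at the end point to functions on the line -/

/-- A function on the half-line can be prolonged by a linear piece to one vanishing at `0`. -/
lemma IsHalfLineSobolev.exists_prolong {f g : ℝ → ℝ} (h : IsHalfLineSobolev f g) {p : ℝ}
    (hp : 2 < p) :
    ∃ F G : ℝ → ℝ, IsHalfLineSobolev F G ∧ F 0 = 0 ∧ halfLinePow p f ≤ halfLinePow p F ∧
      halfLineEnergy F G ≤ halfLineEnergy f g + f 0 ^ 2 *
        halfLineEnergy (fun x => max (1 - x) 0) ((Ioc 0 1).indicator fun _ => -1) := by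
  obtain ⟨u, u', hu, hs, -, hleft, hE, hA⟩ := h.exists_glue
    (isHalfLineSobolev_ramp.const_mul (f 0)) (by simp)
  -- The glued ramp reaches zero at -1, which becomes the new origin.
  refine ⟨_, _, hs.isHalfLineSobolev_right hu (-1), ?_, ?_, ?_⟩
  · simp only [add_zero]
    rw [hleft _ (by norm_num)]
    simp
  · have h1 := hA p hp
    have h2 : halfLinePow p (fun x => u (-1 - x)) = 0 := by
      refine setIntegral_eq_zero_of_forall_eq_zero fun x hx => ?_
      have hx0 : (0 : ℝ) < x := hx
      simp only
      rw [hleft _ (by linarith), max_eq_right (by linarith), mul_zero, abs_zero,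
        Real.zero_rpow (by linarith)]
    rw [hs.integral_rpow_eq hu hp (-1), h2, add_zero] at h1
    rw [h1]
    exact le_add_of_nonneg_right (halfLinePow_nonneg _ _)
  · rw [← halfLineEnergy_const_mul, ← hE, hs.integral_energy_eq hu (-1)]
    exact le_add_of_nonneg_right (halfLineEnergy_nonneg _ _)

/-- For admissibility it suffices to consider functions on the half-line vanishing at `0`. -/
lemma isPairConstant_of_forall_eq_zero {p C : ℝ} (hp : 2 < p)
    (hC : ∀ f g, IsHalfLineSobolev f g → f 0 = 0 →
      halfLinePow p f ^ (2 / p) ≤ C * halfLineEnergy f g) : IsPairConstant p C := by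
  have hp0 : 0 < p := by linarith
  set K := halfLineEnergy (fun x => max (1 - x) 0) ((Ioc 0 1).indicator fun _ => -1) with hK
  -- The sign is needed to multiply energy estimates by `C`; it follows by testing with a prolonged
  -- ramp.
  have hC0 : 0 ≤ C := by
    obtain ⟨F, G, h, h0, hA, -⟩ := isHalfLineSobolev_ramp.exists_prolong hp
    have h1 : 0 < halfLinePow p F :=
      (isHalfLineSobolev_ramp.halfLinePow_pos hp le_rfl (by simp)).trans_le hA
    have h2 : 0 < C * halfLineEnergy F G := (Real.rpow_pos_of_pos h1 _).trans_le (hC F G h h0)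
    exact (pos_of_mul_pos_left h2 (halfLineEnergy_nonneg _ _)).le
  rw [isPairConstant_iff hp]
  intro v v' hv hs
  have hvI : Integrable (fun x => energyDensity v v' x) :=
    integrable_energyDensity (by simpa using hs.memLp) (by simpa using hs.memLp_deriv)
  have hpI : Integrable fun x => |v x| ^ p := by
    have h1 := (hs.isHalfLineSobolev_right hv 0).integrableOn_rpow hp
    have h2 := (hs.isHalfLineSobolev_left hv 0).integrableOn_rpow hp
    have h1' : IntegrableOn (fun x => |v x| ^ p) (Ioi 0) := by simpa using h1
    have h2' : IntegrableOn (fun x => |v x| ^ p) (Iio 0) :=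
      ((measurePreserving_const_sub_Iio 0).integrable_comp_emb
        (measurableEmbedding_const_sub 0)).1 h2
    rw [← integrableOn_univ, ← Iic_union_Ioi (a := (0 : ℝ))]
    exact ((integrableOn_Iic_iff_integrableOn_Iio).2 h2').union h1'
  have hle : ∀ t : ℝ, (∫ x in Ioi (-t), |v x| ^ p) ^ (2 / p)
      ≤ C * ((∫ x in Ioi (-t), energyDensity v v' x) + v (-t) ^ 2 * K) := by
    intro t
    obtain ⟨F, G, h, h0, hA, hE⟩ := (hs.isHalfLineSobolev_right hv (-t)).exists_prolong hp
    rw [halfLinePow_shift] at hA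
    rw [halfLineEnergy_shift, ← hK, add_zero] at hE
    calc _ ≤ halfLinePow p F ^ (2 / p) :=
          Real.rpow_le_rpow (integral_nonneg fun x => by positivity) hA (by positivity)
      _ ≤ C * halfLineEnergy F G := hC F G h h0
      _ ≤ _ := mul_le_mul_of_nonneg_left hE hC0
  have hcov : AECover volume Filter.atTop fun t : ℝ => Ioi (-t) :=
    aecover_Ioi Filter.tendsto_neg_atTop_atBot
  have ht1 := hcov.integral_tendsto_of_countably_generated hpI
  have ht2 := hcov.integral_tendsto_of_countably_generated hvI
  -- The cost of the ramp vanishes in the limit: `v (-t) ^ 2` is at most twice the energy to the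
  -- left of `-t`.
  have ht3 : Filter.Tendsto (fun t : ℝ => v (-t) ^ 2) Filter.atTop (nhds 0) := by
    have h1 : Filter.Tendsto (fun t : ℝ => 2 * ((∫ x, energyDensity v v' x)
        - ∫ x in Ioi (-t), energyDensity v v' x)) Filter.atTop (nhds 0) := by
      have := (ht2.const_sub (∫ x, energyDensity v v' x)).const_mul 2
      simpa using this
    refine squeeze_zero (fun t => sq_nonneg _) (fun t => ?_) h1
    have h2 := (hs.isHalfLineSobolev_left hv (-t)).sq_le_two_mul_energy le_rfl
    have h3 := hs.integral_energy_eq hv (-t)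
    rw [halfLineEnergy_shift] at h3
    rw [h3, add_sub_cancel_left]
    simpa using h2
  have hlim := le_of_tendsto_of_tendsto' (ht1.rpow_const (p := 2 / p) (Or.inr (by positivity)))
    ((ht2.add (ht3.mul_const K)).const_mul C) hle
  simpa [energyDensity] using hlim

/-- The primitive formula holds only for `x ≥ 0`, so `g` is extended by zero; its primitive on the
line agrees with `f` on the half-line. -/
lemma IsHalfLineSobolev.isSobolevOn {f g : ℝ → ℝ} (h : IsHalfLineSobolev f g) :
    IsSobolevOn (Ioi 0) f g := by
  refine ⟨h.memLp, h.memLp_deriv, ?_⟩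
  have hg : MemLp ((Ioi 0).indicator g) 2 :=
    (memLp_indicator_iff_restrict measurableSet_Ioi).2 h.memLp_deriv
  have hw := hasWeakDerivOn_of_forall_eq_add_integral (I := Ioi 0) (g := (Ioi 0).indicator g)
    (f := fun x => f 0 + ∫ t in 0..x, (Ioi 0).indicator g t)
    (fun c d => ((hg.locallyIntegrable (by norm_num)).integrableOn_isCompact
      isCompact_uIcc).intervalIntegrable) (by simp)
  intro φ h1 h2 h3
  have := hw φ h1 h2 h3
  have e₁ : ∫ x in Ioi 0, (f 0 + ∫ t in 0..x, (Ioi 0).indicator g t) * deriv φ x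
      = ∫ x in Ioi 0, f x * deriv φ x := by
    refine setIntegral_congr_fun measurableSet_Ioi fun x hx => ?_
    have hx0 : (0 : ℝ) ≤ x := le_of_lt hx
    rw [h.eq_add_integral x hx0, intervalIntegral.integral_of_le hx0,
      intervalIntegral.integral_of_le hx0,
      setIntegral_congr_fun measurableSet_Ioc fun t ht => indicator_of_mem (mem_Ioi.2 ht.1) g]
  have e₂ : ∫ x in Ioi 0, (Ioi 0).indicator g x * φ x = ∫ x in Ioi 0, g x * φ x := by
    refine setIntegral_congr_fun measurableSet_Ioi fun x hx => ?_
    rw [indicator_of_mem hx]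
  exact e₁.symm.trans (this.trans (congrArg Neg.neg e₂))

/-! ### Functions on a metric graph, extended by zero from each edge -/

namespace MetricGraph

variable {V E : Type*} {G : MetricGraph V E}

lemma interval_eq_Ioi {e : E} (h : G.len e = ⊤) : G.interval e = Ioi 0 := by
  ext x
  simp [interval, h]

lemma interval_eq_Ioo {e : E} (h : G.len e ≠ ⊤) : G.interval e = Ioo 0 (G.len e).toReal := by
  ext x
  simp only [interval, mem_ofPred_eq, mem_Ioo, and_congr_right_iff]
  intro hx
  exact ENNReal.ofReal_lt_iff_lt_toReal hx.le h

lemma closedInterval_eq_Ici {e : E} (h : G.len e = ⊤) : G.closedInterval e = Ici 0 := by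
  ext x
  simp [closedInterval, h]

lemma closedInterval_eq_Icc {e : E} (h : G.len e ≠ ⊤) :
    G.closedInterval e = Icc 0 (G.len e).toReal := by
  ext x
  simp only [closedInterval, mem_ofPred_eq, mem_Icc, ENNReal.ofReal_le_iff_le_toReal h]

lemma measurableSet_interval (e : E) : MeasurableSet (G.interval e) := by
  by_cases h : G.len e = ⊤
  · rw [interval_eq_Ioi h]; exact measurableSet_Ioi
  · rw [interval_eq_Ioo h]; exact measurableSet_Ioo

lemma interval_subset_Ioi (e : E) : G.interval e ⊆ Ioi 0 := fun _ hx => hx.1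

lemma interval_subset_closedInterval (e : E) : G.interval e ⊆ G.closedInterval e :=
  fun _ hx => ⟨hx.1.le, hx.2.le⟩

lemma zero_mem_closedInterval (e : E) : (0 : ℝ) ∈ G.closedInterval e := by
  simp [closedInterval]

lemma Icc_subset_closedInterval {e : E} {x : ℝ} (hx : x ∈ G.closedInterval e) :
    Icc 0 x ⊆ G.closedInterval e :=
  fun _ hy => ⟨hy.1, (ENNReal.ofReal_le_ofReal hy.2).trans hx.2⟩

lemma Ioo_subset_interval {e : E} {x : ℝ} (hx : x ∈ G.closedInterval e) :
    Ioo 0 x ⊆ G.interval e :=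
  fun _ hy => ⟨hy.1, ((ENNReal.ofReal_lt_ofReal_iff_of_nonneg hy.1.le).2 hy.2).trans_le hx.2⟩

namespace H10

/-- The function on the edge `e`, extended by zero to the line. -/
def extVal (v : G.H10) (e : E) : ℝ → ℝ := (G.closedInterval e).indicator (v.val e)

/-- The weak derivative on the edge `e`, extended by zero to the line. -/
def extDer (v : G.H10) (e : E) : ℝ → ℝ := (G.interval e).indicator (v.der e)

lemma extVal_zero (v : G.H10) (e : E) : v.extVal e 0 = v.vertexVal (G.init e) := by
  rw [extVal, indicator_of_mem (zero_mem_closedInterval e), v.val_init]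

/-- On (0, ∞) the closed and the open edge differ at most at the far end point, a null set. -/
lemma extVal_ae_eq (v : G.H10) (e : E) :
    v.extVal e =ᵐ[volume.restrict (Ioi 0)] (G.interval e).indicator (v.val e) := by
  rw [Filter.EventuallyEq, ae_restrict_iff' measurableSet_Ioi]
  have h : ∀ᵐ x : ℝ, x ≠ (G.len e).toReal := by
    rw [ae_iff]
    simp
  filter_upwards [h] with x hx hx0
  by_cases hxI : x ∈ G.interval e
  · rw [extVal, indicator_of_mem hxI, indicator_of_mem (interval_subset_closedInterval e hxI)]
  · rw [extVal, indicator_of_notMem hxI, indicator_of_notMem]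
    intro hxJ
    refine hxI ⟨hx0, lt_of_le_of_ne hxJ.2 fun heq => hx ?_⟩
    rw [← heq, ENNReal.toReal_ofReal hxJ.1]

/-- The zero value at the far vertex makes the extension continuous: past the end, the integral of
the derivative over the whole edge cancels the initial value. -/
lemma isHalfLineSobolev_ext (v : G.H10) {e : E} (he : ∀ a, G.term e = some a → v.vertexVal a = 0) :
    IsHalfLineSobolev (v.extVal e) (v.extDer e) := by
  have hs := v.isSobolevOn e
  have hI := measurableSet_interval (G := G) e
  refine ⟨(((memLp_indicator_iff_restrict hI).2 hs.memLp).restrict _).ae_eq (v.extVal_ae_eq e).symm,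
    ((memLp_indicator_iff_restrict hI).2 hs.memLp_deriv).restrict _, fun x hx => ?_⟩
  have key : ∀ y ∈ G.closedInterval e, v.val e y - v.val e 0 = ∫ t in Ioo 0 y, v.der e t := by
    intro y hy
    rw [HasWeakDerivOn.sub_eq_integral_Icc hy.1
      ((v.continuousOn e).mono (Icc_subset_closedInterval hy)) ?_
      (hs.hasWeakDerivOn.mono hI (Ioo_subset_interval hy)), intervalIntegral.integral_of_le hy.1,
      integral_Ioc_eq_integral_Ioo]
    exact (hs.memLp_deriv.mono_measure (Measure.restrict_mono (Ioo_subset_interval hy) le_rfl)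
      ).integrable (by norm_num)
  rw [intervalIntegral.integral_of_le hx, integral_Ioc_eq_integral_Ioo, extDer,
    setIntegral_indicator hI, extVal, indicator_of_mem (zero_mem_closedInterval e)]
  by_cases hxJ : x ∈ G.closedInterval e
  · rw [indicator_of_mem hxJ, inter_eq_left.2 (Ioo_subset_interval hxJ), ← key x hxJ]
    ring
  · have hlen : G.len e ≠ ⊤ := fun h => hxJ (by rw [closedInterval_eq_Ici h]; exact hx)
    have hL : (G.len e).toReal ∈ G.closedInterval e := by
      rw [closedInterval_eq_Icc hlen]
      exact right_mem_Icc.2 ENNReal.toReal_nonneg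
    have hLx : (G.len e).toReal < x := by
      rw [closedInterval_eq_Icc hlen] at hxJ
      by_contra! h
      exact hxJ ⟨hx, h⟩
    have h0 : v.val e (G.len e).toReal = 0 := by
      cases ht : G.term e with
      | none => exact absurd ((G.term_eq_none_iff e).1 ht) hlen
      | some a => rw [v.val_term e a ht, he a ht]
    rw [indicator_of_notMem hxJ, interval_eq_Ioo hlen,
      inter_eq_right.2 (Ioo_subset_Ioo_right hLx.le), ← key _ hL, h0]
    ring

lemma halfLineEnergy_ext (v : G.H10) (e : E) : halfLineEnergy (v.extVal e) (v.extDer e)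
    = ∫ x in G.interval e, (|v.der e x| ^ 2 + |v.val e x| ^ 2) := by
  rw [← inter_eq_right.2 (interval_subset_Ioi (G := G) e),
    ← setIntegral_indicator (measurableSet_interval e), halfLineEnergy]
  refine integral_congr_ae ?_
  filter_upwards [v.extVal_ae_eq e] with x hx
  rw [energyDensity, hx, extDer]
  by_cases h : x ∈ G.interval e <;> simp [h]

lemma halfLinePow_ext (v : G.H10) (e : E) {p : ℝ} (hp : 2 < p) : halfLinePow p (v.extVal e)
    = ∫ x in G.interval e, |v.val e x| ^ p := by
  rw [← inter_eq_right.2 (interval_subset_Ioi (G := G) e),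
    ← setIntegral_indicator (measurableSet_interval e), halfLinePow]
  refine integral_congr_ae ?_
  filter_upwards [v.extVal_ae_eq e] with x hx
  rw [hx]
  by_cases h : x ∈ G.interval e
  · simp [h]
  · simp [h, Real.zero_rpow (by linarith : p ≠ 0)]

variable [Fintype E]

lemma energy_eq_sum (v : G.H10) : v.energy = ∑ e, halfLineEnergy (v.extVal e) (v.extDer e) :=
  Finset.sum_congr rfl fun e _ => (v.halfLineEnergy_ext e).symm

lemma powIntegral_eq_sum (v : G.H10) {p : ℝ} (hp : 2 < p) :
    v.powIntegral p = ∑ e, halfLinePow p (v.extVal e) :=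
  Finset.sum_congr rfl fun e _ => (v.halfLinePow_ext e hp).symm

lemma powIntegral_eq_zero_of_not_neZero (v : G.H10) {p : ℝ} (hp : 2 < p) (hv : ¬ v.NeZero) :
    v.powIntegral p = 0 := by
  refine Finset.sum_eq_zero fun e _ => setIntegral_eq_zero_of_forall_eq_zero fun x hx => ?_
  have : v.val e x = 0 := by
    by_contra h
    exact hv ⟨e, x, interval_subset_closedInterval e hx, h⟩
  rw [this, abs_zero, Real.zero_rpow (by linarith)]

lemma energy_nonneg (v : G.H10) : 0 ≤ v.energy :=
  Finset.sum_nonneg fun e _ => integral_nonneg fun x => by positivity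

/-- The reciprocal of the minimal quotient is an admissible constant. Positivity of the power
integrals allows clearing denominators; the zero function is trivial. -/
lemma IsMinimizer.rpow_le {p : ℝ} (hp : 2 < p) {v : G.H10} (hv : v.IsMinimizer p)
    (hA : 0 < v.powIntegral p) (hE : 0 < v.energy)
    (hpos : ∀ w : G.H10, w.NeZero → 0 < w.powIntegral p) (w : G.H10) :
    w.powIntegral p ^ (2 / p) ≤ v.powIntegral p ^ (2 / p) / v.energy * w.energy := by
  have hp0 : 0 < p := by linarith
  by_cases hw : w.NeZero
  · have h := hv.2 w hw
    rw [quotient, quotient, div_le_div_iff₀ (Real.rpow_pos_of_pos hA _)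
      (Real.rpow_pos_of_pos (hpos w hw) _)] at h
    rw [div_mul_eq_mul_div, le_div_iff₀ hE]
    linarith
  · rw [w.powIntegral_eq_zero_of_not_neZero hp hw, Real.zero_rpow (by positivity)]
    have := w.energy_nonneg
    positivity

end H10

end MetricGraph

/-! ### The half-line with attached edges -/

section HalfLineWithEdges

open MetricGraph

variable {ι : Type*} {ℓ : ι → ℝ≥0∞} {hℓ : ∀ i, 0 < ℓ i}

lemma halfLineWithEdges_isOuter (i : {i : ι // ℓ i ≠ ⊤}) :
    (halfLineWithEdges ℓ hℓ).IsOuter (some i) := by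
  refine ⟨some i.1, Or.inr ?_, fun e he => ?_⟩
  · simp [halfLineWithEdges, i.2]
  · rcases he with he | he
    · simp [halfLineWithEdges] at he
    · cases e with
      | none => simp [halfLineWithEdges] at he
      | some j =>
        simp only [halfLineWithEdges, Option.elim_some] at he
        split_ifs at he with h
        simp only [Option.some.injEq] at he
        rw [← he]

/-- Without attached edges P lies on `e₀` alone, so the boundary condition applies at P itself. -/
lemma halfLineWithEdges_isOuter_none [IsEmpty ι] :
    (halfLineWithEdges ℓ hℓ).IsOuter none :=
  ⟨none, Or.inl rfl, fun e _ => by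
    cases e with
    | none => rfl
    | some i => exact isEmptyElim i⟩

lemma isHalfLineSobolev_ext_halfLineWithEdges (v : (halfLineWithEdges ℓ hℓ).H10) (e : Option ι) :
    IsHalfLineSobolev (v.extVal e) (v.extDer e) := by
  refine v.isHalfLineSobolev_ext fun a ha => ?_
  cases a with
  | none => exact absurd ha ((halfLineWithEdges ℓ hℓ).term_ne_init e)
  | some i => exact v.eq_zero_of_isOuter _ (halfLineWithEdges_isOuter i)

/-- A function on the half-line that vanishes at `0`, extended by zero to the attached edges. -/
def IsHalfLineSobolev.toH10 {f g : ℝ → ℝ} (h : IsHalfLineSobolev f g) (h0 : f 0 = 0) :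
    (halfLineWithEdges ℓ hℓ).H10 where
  val e := e.elim f fun _ _ => 0
  der e := e.elim g fun _ _ => 0
  vertexVal _ := 0
  isSobolevOn e := by
    cases e with
    | none =>
      rw [interval_eq_Ioi (by rfl)]
      exact h.isSobolevOn
    | some i => exact ⟨MemLp.zero, MemLp.zero, fun φ _ _ _ => by simp⟩
  continuousOn e := by
    cases e with
    | none =>
      rw [closedInterval_eq_Ici (by rfl)]
      exact h.continuousOn
    | some i => exact continuousOn_const
  val_init e := by
    cases e with
    | none => exact h0
    | some i => rfl
  val_term e a ha := by
    cases e with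
    | none => simp [halfLineWithEdges] at ha
    | some i => rfl
  eq_zero_of_isOuter _ _ := rfl

variable [Fintype ι]

lemma IsHalfLineSobolev.energy_toH10 {f g : ℝ → ℝ} (h : IsHalfLineSobolev f g) (h0 : f 0 = 0) :
    (h.toH10 h0 : (halfLineWithEdges ℓ hℓ).H10).energy = halfLineEnergy f g := by
  rw [H10.energy, Fintype.sum_option, interval_eq_Ioi (by rfl)]
  simp [IsHalfLineSobolev.toH10, halfLineEnergy, energyDensity]

lemma IsHalfLineSobolev.powIntegral_toH10 {f g : ℝ → ℝ} (h : IsHalfLineSobolev f g)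
    (h0 : f 0 = 0) {p : ℝ} (hp : 2 < p) :
    (h.toH10 h0 : (halfLineWithEdges ℓ hℓ).H10).powIntegral p = halfLinePow p f := by
  rw [H10.powIntegral, Fintype.sum_option, interval_eq_Ioi (by rfl)]
  simp [IsHalfLineSobolev.toH10, halfLinePow, Real.zero_rpow (by linarith : p ≠ 0)]

/-- The Sobolev inequality holds with the same constants on the graph and on the line. -/
lemma isPairConstant_iff_halfLineWithEdges (ℓ : ι → ℝ≥0∞) (hℓ : ∀ i, 0 < ℓ i) {p C : ℝ}
    (hp : 2 < p) : IsPairConstant p C ↔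
      ∀ v : (halfLineWithEdges ℓ hℓ).H10, v.powIntegral p ^ (2 / p) ≤ C * v.energy := by
  constructor
  · intro hC v
    have h := isHalfLineSobolev_ext_halfLineWithEdges v
    rw [v.powIntegral_eq_sum hp, v.energy_eq_sum]
    have h0 : ∀ i j, v.extVal i 0 = v.extVal j 0 := fun i j => by
      rw [v.extVal_zero, v.extVal_zero]; rfl
    rcases isEmpty_or_nonempty ι with hι | hι
    · have := hC _ _ _ _ (h none) IsHalfLineSobolev.zero
        (by rw [v.extVal_zero]; exact v.eq_zero_of_isOuter _ halfLineWithEdges_isOuter_none)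
      rw [halfLinePow_zero hp, halfLineEnergy_zero] at this
      simpa only [Fintype.sum_option, Finset.univ_eq_empty, Finset.sum_empty, add_zero] using this
    · exact hC.sum_rpow_le hp h h0 (by
        rw [Fintype.card_option]; have := Fintype.card_pos (α := ι); omega)
  · intro hC
    refine isPairConstant_of_forall_eq_zero hp fun f g h h0 => ?_
    have := hC (h.toH10 h0)
    rwa [h.energy_toH10, h.powIntegral_toH10 h0 hp] at this

lemma lineBestConstant_eq_sInf {p : ℝ} (hp : 2 < p) :
    lineBestConstant p = sInf {C | IsPairConstant p C} := by
  simp only [lineBestConstant, isPairConstant_iff hp]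

lemma bestConstant_halfLineWithEdges (ℓ : ι → ℝ≥0∞) (hℓ : ∀ i, 0 < ℓ i) {p : ℝ} (hp : 2 < p) :
    (halfLineWithEdges ℓ hℓ).bestConstant p = sInf {C | IsPairConstant p C} := by
  simp only [bestConstant, isPairConstant_iff_halfLineWithEdges ℓ hℓ hp]

lemma powIntegral_pos_and_energy_pos {p : ℝ} (hp : 2 < p) {v : (halfLineWithEdges ℓ hℓ).H10}
    (hv : v.NeZero) : 0 < v.powIntegral p ∧ 0 < v.energy := by
  obtain ⟨e, x, hx, hne⟩ := hv
  have h := isHalfLineSobolev_ext_halfLineWithEdges v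
  have hne' : v.extVal e x ≠ 0 := by rwa [H10.extVal, indicator_of_mem hx]
  rw [v.powIntegral_eq_sum hp, v.energy_eq_sum]
  exact ⟨Finset.sum_pos' (fun e _ => halfLinePow_nonneg p _)
      ⟨e, Finset.mem_univ e, (h e).halfLinePow_pos hp hx.1 hne'⟩,
    Finset.sum_pos' (fun e _ => halfLineEnergy_nonneg _ _)
      ⟨e, Finset.mem_univ e, (h e).halfLineEnergy_pos hx.1 hne'⟩⟩

/-- A function for which the Sobolev inequality is an equality vanishes, unless the graph is a
line. -/
lemma powIntegral_eq_zero_of_le {p C : ℝ} (hp : 2 < p) (hC : IsPairConstant p C) (hC0 : 0 < C)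
    (hι : ¬ (Fintype.card ι = 1 ∧ ∀ i, ℓ i = ⊤)) {v : (halfLineWithEdges ℓ hℓ).H10}
    (hle : C * v.energy ≤ v.powIntegral p ^ (2 / p)) : v.powIntegral p = 0 := by
  have h := isHalfLineSobolev_ext_halfLineWithEdges v
  have h0 : ∀ i j, v.extVal i 0 = v.extVal j 0 := fun i j => by
    rw [v.extVal_zero, v.extVal_zero]; rfl
  rw [v.energy_eq_sum, v.powIntegral_eq_sum hp] at hle
  rw [v.powIntegral_eq_sum hp]
  obtain hcard | hcard | hcard : Fintype.card ι = 0 ∨ Fintype.card ι = 1 ∨ 2 ≤ Fintype.card ι := by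
    omega
  · have : IsEmpty ι := Fintype.card_eq_zero_iff.1 hcard
    simp only [Fintype.sum_option, Finset.univ_eq_empty, Finset.sum_empty, add_zero] at hle ⊢
    exact hC.halfLinePow_eq_zero hp hC0 (h none)
      (by rw [v.extVal_zero]; exact v.eq_zero_of_isOuter _ halfLineWithEdges_isOuter_none) hle
  · obtain ⟨i, hi⟩ := Fintype.card_eq_one_iff.1 hcard
    have hlen : ℓ i ≠ ⊤ := fun ht => hι ⟨hcard, fun j => by rw [hi j, ht]⟩
    have huniv : (Finset.univ : Finset ι) = {i} := by
      ext j
      simp [hi j]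
    simp only [Fintype.sum_option, huniv, Finset.sum_singleton] at hle ⊢
    refine hC.halfLinePow_add_eq_zero hp hC0 (h none) (h (some i)) (h0 _ _)
      -- The `+ 1` moves past the end point, which still belongs to the closed edge.
      (L := (ℓ i).toReal + 1) (by positivity) (fun x hx => ?_) hle
    rw [H10.extVal, indicator_of_notMem]
    rw [closedInterval_eq_Icc (e := some i) hlen]
    intro hx'
    have : x ≤ (ℓ i).toReal := hx'.2
    linarith
  · by_contra hne
    have hS : 0 < ∑ e, halfLinePow p (v.extVal e) :=
      (Finset.sum_nonneg fun e _ => halfLinePow_nonneg p _).lt_of_ne' hne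
    obtain ⟨e, he⟩ := hC.exists_forall_ne_halfLinePow_eq_zero hp h h0
      (by rw [Fintype.card_option]; omega) hS hle
    -- Any other edge carries no power, so its function is zero; this forces the value 0 at the
    -- common vertex.
    obtain ⟨e', he'⟩ : ∃ e', e' ≠ e := Fintype.exists_ne_of_one_lt_card
      (by rw [Fintype.card_option]; omega) e
    have hsum : ∑ e, halfLinePow p (v.extVal e) = halfLinePow p (v.extVal e) :=
      Fintype.sum_eq_single e he
    rw [hsum] at hle hne
    refine hne (hC.halfLinePow_eq_zero hp hC0 (h e) ?_ (le_trans ?_ hle))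
    · rw [h0 e e']
      exact (h e').eq_zero_of_halfLinePow_eq_zero hp (he e' he') le_rfl
    · exact mul_le_mul_of_nonneg_left (Finset.single_le_sum
        (f := fun e => halfLineEnergy (v.extVal e) (v.extDer e))
        (fun e _ => halfLineEnergy_nonneg _ _) (Finset.mem_univ e)) hC0.le

end HalfLineWithEdges

end

/-! ### The main theorem -/

/-- Let `G` be a half-line with finitely many bounded or unbounded edges attached at its finite
vertex. Then `C_p(G) = C_p(ℝ)`, which is a positive real number, and the minimisation problem has no
solution on `G`, unless `G` consists of exactly two half-lines (and so is a copy of `ℝ`). -/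
theorem mainTheorem1 {ι : Type*} [Fintype ι] (p : ℝ) (hp : 2 < p)
    (ℓ : ι → ℝ≥0∞) (hℓ : ∀ i, 0 < ℓ i) :
    (¬ (Fintype.card ι = 1 ∧ ∀ i, ℓ i = ⊤) →
      ¬ ∃ v : (halfLineWithEdges ℓ hℓ).H10, v.IsMinimizer p) ∧
    0 < lineBestConstant p ∧
    (halfLineWithEdges ℓ hℓ).bestConstant p = lineBestConstant p := by
  rw [lineBestConstant_eq_sInf hp, bestConstant_halfLineWithEdges ℓ hℓ hp]
  refine ⟨?_, sInf_isPairConstant_pos hp, rfl⟩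
  rintro hι ⟨v, hv⟩
  obtain ⟨hA, hE⟩ := powIntegral_pos_and_energy_pos hp hv.1
  -- The constant attained by the minimiser is admissible on the graph, hence on the line, so it is
  -- at least the infimum. This is the reverse inequality that makes `v` an extremal.
  have hmem : IsPairConstant p (v.powIntegral p ^ (2 / p) / v.energy) :=
    (isPairConstant_iff_halfLineWithEdges ℓ hℓ hp).2
      (hv.rpow_le hp hA hE fun w hw => (powIntegral_pos_and_energy_pos hp hw).1)
  have hle := mul_le_mul_of_nonneg_right
    (csInf_le ⟨0, fun C hC => IsPairConstant.nonneg hp hC⟩ hmem) hE.le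
  rw [div_mul_cancel₀ _ hE.ne'] at hle
  exact hA.ne' (powIntegral_eq_zero_of_le hp (isPairConstant_sInf hp)
    (sInf_isPairConstant_pos hp) hι hle)
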